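/- Let $\mathbf F=\mathbf R$ or $\mathbf F=\mathbf C$, let $A_1,\dots,A_n\in\mathbf F^{d\times d}$ be Hermitian positive semidefinite matrices, and let $x_*\in\mathbf F^d$. Write $\langle A,S\rangle=\operatorname{Re}\operatorname{tr}(A^*S)$, $\mathcal A(S)=(\langle A_1,S\rangle,\dots,\langle A_n,S\rangle)\in\mathbf R^n$ and $\mathcal A^*(z)=\sum_{i=1}^n z_iA_i$; $\|\cdot\|$ is the Euclidean norm, $\|\cdot\|_F$ the Frobenius norm and $\|\cdot\|_{\mathrm{op}}$ the $\ell_2$ operator norm. Consider, with the exact measurements $y=\mathcal A(x_*x_*^*)$, the function $f(x)=\|y-\mathcal A(xx^*)\|^2$ on $\mathbf F^d$. A second-order critical point of $f$ is a point where the gradient of $f$ is zero and its Hessian is positive semidefinite, both taken with respect to the real coordinates (the real and imaginary parts if $\mathbf F=\mathbf C$). (1) Suppose that for some $m,\delta_L,\delta_U>0$ $$\tfrac1n\|\mathcal A^*\mathcal A(x_*x_*^*)\|_{\mathrm{op}}\le(1+m+\delta_U)\|x_*\|^2,$$ $$\tfrac1n\|\mathcal A(xx^*-x_*x_*^*)\|^2\ge(1-\delta_L)\left[m\|xx^*-x_*x_*^*\|_F^2+(\|x\|^2-\|x_*\|^2)^2\right]\quad\text{for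 all }x\in\mathbf F^d,$$ $$m^2+2m-2>3(m^2+2m)\delta_L+2(m+1)\delta_U.$$ Then every second-order critical point $x$ of $f$ satisfies $xx^*=x_*x_*^*$, that is, $x=x_*s$ for some $s\in\mathbf F$ with $|s|=1$. (2) Let $\gamma$ be the standard real or complex normal law (in the complex case, the real and imaginary parts are independent of law $N(0,\tfrac12)$), and put $m_4=\mathbf E_{z\sim\gamma}|z|^4-1$. There are universal constants $c_1,c_2>0$ and, in each of the three cases below, universal constants $\delta_L,\delta_U>0$ such that the following holds. Let $n\ge1$, $n\ge c_1d\log d$, let $x_*\in\mathbf F^d$ be fixed, and let $a_1,\dots,a_n$ be i.i.d. random vectors whose $d$ entries are i.i.d. of law $\gamma$. Then with $m=m_4$, the third inequality of part (1) holds, and, with probability at least $1-c_2n^{-2}$, so do the first two inequalities of part (1), in each of the cases: $\mathbf F=\mathbf R$, $\gamma$ real, $A_i=a_ia_i^*$; $\mathbf F=\mathbf C$, $\gamma$ complex, $A_i=a_ia_i^*$; $\mathbf F=\mathbf R$, $\gamma$ complex, $A_i=\operatorname{Re}(a_ia_i^*)$. -/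

import Mathlib

open MeasureTheory ProbabilityTheory

namespace PhaseRetrieval

/-- The outer product `x x^*` of a vector `x`. -/
def outer {𝕜 : Type*} [RCLike 𝕜] {d : ℕ} (x : Fin d → 𝕜) : Matrix (Fin d) (Fin d) 𝕜 :=
  Matrix.vecMulVec x (star x)

/-- The Frobenius norm of a matrix. -/
noncomputable def frobNorm {𝕜 : Type*} [RCLike 𝕜] {d : ℕ} (M : Matrix (Fin d) (Fin d) 𝕜) : ℝ :=
  Real.sqrt (∑ i, ∑ j, ‖M i j‖ ^ 2)

/-- The `ℓ₂ → ℓ₂` operator norm of a matrix. -/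
noncomputable def opNorm {𝕜 : Type*} [RCLike 𝕜] {d : ℕ} (M : Matrix (Fin d) (Fin d) 𝕜) : ℝ :=
  ‖Matrix.toEuclideanCLM (n := Fin d) (𝕜 := 𝕜) M‖

/-- The measurement operator `𝒜(S) = (⟨A₁, S⟩, …, ⟨Aₙ, S⟩)`, where `⟨A, S⟩ = Re tr (A^* S)`
(which is `tr (A S)` if `A` and `S` are Hermitian). -/
noncomputable def measOp {𝕜 : Type*} [RCLike 𝕜] {d n : ℕ}
    (A : Fin n → Matrix (Fin d) (Fin d) 𝕜) (S : Matrix (Fin d) (Fin d) 𝕜) :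
    EuclideanSpace ℝ (Fin n) :=
  WithLp.toLp 2 (fun i => RCLike.re ((A i).conjTranspose * S).trace)

/-- The adjoint `𝒜^*(z) = ∑ᵢ zᵢ Aᵢ` of the measurement operator. -/
noncomputable def measAdj {𝕜 : Type*} [RCLike 𝕜] {d n : ℕ}
    (A : Fin n → Matrix (Fin d) (Fin d) 𝕜) (z : EuclideanSpace ℝ (Fin n)) :
    Matrix (Fin d) (Fin d) 𝕜 :=
  ∑ i, z i • A i

/-- The least-squares objective `f(x) = ‖y - 𝒜(x x^*)‖²`. -/
noncomputable def objective {𝕜 : Type*} [RCLike 𝕜] {d n : ℕ}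
    (A : Fin n → Matrix (Fin d) (Fin d) 𝕜) (y : EuclideanSpace ℝ (Fin n))
    (x : EuclideanSpace 𝕜 (Fin d)) : ℝ :=
  ‖y - measOp A (outer x.ofLp)‖ ^ 2

/-- `x` is a second-order critical point of the (smooth) function `f`: the first derivative of `f`
at `x` is zero and the Hessian quadratic form of `f` at `x` is positive semidefinite. Derivatives
are over `ℝ`, so for complex vectors they are taken in the real and imaginary parts. -/
def IsSecondOrderCritical {E : Type*} [NormedAddCommGroup E] [NormedSpace ℝ E]
    (f : E → ℝ) (x : E) : Prop :=
  fderiv ℝ f x = 0 ∧ ∀ v : E, 0 ≤ iteratedFDeriv ℝ 2 f x ![v, v]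

/-- The upper bound on `𝒜^* 𝒜 (x_* x_*^*)` and the restricted lower isometry inequality. -/
def MeasurementCondition {𝕜 : Type*} [RCLike 𝕜] {d n : ℕ}
    (A : Fin n → Matrix (Fin d) (Fin d) 𝕜) (xs : EuclideanSpace 𝕜 (Fin d))
    (m δL δU : ℝ) : Prop :=
  (1 / (n : ℝ)) * opNorm (measAdj A (measOp A (outer xs.ofLp))) ≤ (1 + m + δU) * ‖xs‖ ^ 2 ∧
  ∀ x : EuclideanSpace 𝕜 (Fin d),
    (1 - δL) * (m * frobNorm (outer x.ofLp - outer xs.ofLp) ^ 2 + (‖x‖ ^ 2 - ‖xs‖ ^ 2) ^ 2) ≤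
      (1 / (n : ℝ)) * ‖measOp A (outer x.ofLp - outer xs.ofLp)‖ ^ 2

/-- The numerical requirements on the constants `m, δL, δU`. -/
def AdmissibleConstants (m δL δU : ℝ) : Prop :=
  0 < m ∧ 0 < δL ∧ 0 < δU ∧
    3 * (m ^ 2 + 2 * m) * δL + 2 * (m + 1) * δU < m ^ 2 + 2 * m - 2

/-- The law of a standard real normal random variable. -/
noncomputable def stdReal : Measure ℝ := gaussianReal 0 1

/-- The law of a standard complex normal random variable: independent real and imaginary parts,
each of law `N(0, 1/2)`. -/
noncomputable def stdComplex : Measure ℂ :=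
  ((gaussianReal 0 (1 / 2)).prod (gaussianReal 0 (1 / 2))).map
    (fun p : ℝ × ℝ => Complex.mk p.1 p.2)

/-- `E |z|⁴ - 1` for `z` of law `γ`. -/
noncomputable def moment4 {𝕜 : Type*} [RCLike 𝕜] [MeasurableSpace 𝕜] (γ : Measure 𝕜) : ℝ :=
  (∫ z, ‖z‖ ^ 4 ∂γ) - 1

/-- `a₁, …, aₙ` are independent random vectors, each with i.i.d. entries of law `γ`. -/
def IsIIDVectors {𝕜 : Type*} [MeasurableSpace 𝕜] {Ω : Type*} [MeasurableSpace Ω]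
    {d n : ℕ} (γ : Measure 𝕜) (P : Measure Ω) (a : Fin n → Ω → Fin d → 𝕜) : Prop :=
  iIndepFun a P ∧ ∀ i, HasLaw (a i) (Measure.pi (fun _ : Fin d => γ)) P

end PhaseRetrieval

/-! Landscape. Write q_i for the quadratic form of A_i and h_i = q_i(x) - q_i(x_*) for the residuals
at a critical point x. The Hessian is tested in the direction v, the component of x_* orthogonal to
x. Since the A_i are positive semidefinite, Cauchy–Schwarz bounds the squared cross terms Re(v^* A_i
x)^2 by q_i(x) q_i(v), and stationarity turns Σ h_i q_i(v) into -Σ h_i^2. What remains is 3 Σ h_i^2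
≤ 2 Σ q_i(x_*) q_i(v), whose right side is controlled by the operator norm and whose left side is
controlled from below by the restricted isometry. `gap_arithmetic` compares the two by completing a
square; the third hypothesis says exactly that they are incompatible unless ‖x_*‖ ‖v‖ = 0, and then
all residuals vanish and xx^* = x_* x_*^*.

Gaussian upper bound. The summands |⟨a,x_*⟩|^2 |⟨a,u⟩|^2 are quartic in Gaussians and have no
exponential moments. The first factor does not depend on u, so it is truncated at a level K of order
log n, which with high probability changes nothing. The truncated sum satisfies a Chernoff bound
with rate n/K (`mgf_weighted_le`), and a net of the sphere makes it uniform in u. Beating a net of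
size exp(Cd) at rate n/log n is what requires n ≳ d log d.

Gaussian lower bound. After a choice of phase s, |⟨a,x⟩|^2 - |⟨a,y⟩|^2 = Re(⟨a,u⟩ conj⟨a,v⟩) with u
= x + sy and v = x - sy, so it suffices to bound Σ Re(⟨a_i,u⟩ conj⟨a_i,v⟩)^2 from below over pairs
of unit vectors. Clipping both factors at a constant level T only decreases the sum, costs O(T^{-2})
in expectation, and leaves bounded Lipschitz summands, to which Hoeffding's inequality and a net
apply at rate n (`cross_sum_lower_of_net`, `lower_isometry`).

The third model is the complex one restricted to real vectors: Re(aa^*) and aa^* have the same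
quadratic form on real vectors. -/

namespace PhaseRetrieval

/-! ### Second-order critical points: the deterministic landscape. -/

section Deterministic

/-- First and second derivatives along a line on which a smooth function is a quartic polynomial. -/
theorem derivatives_of_quartic_on_line {E : Type*} [NormedAddCommGroup E] [NormedSpace ℝ E]
    {f : E → ℝ} (hf : ContDiff ℝ 2 f) (x v : E) (a₀ a₁ a₂ a₃ a₄ : ℝ)
    (h : ∀ t : ℝ, f (x + t • v) = a₀ + a₁ * t + a₂ * t ^ 2 + a₃ * t ^ 3 + a₄ * t ^ 4) :
    fderiv ℝ f x v = a₁ ∧ iteratedFDeriv ℝ 2 f x ![v, v] = 2 * a₂ := by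
  have hline : ∀ t : ℝ, HasDerivAt (fun t : ℝ => x + t • v) v t := fun t => by
    simpa using ((hasDerivAt_id t).smul_const v).const_add x
  have hd : Differentiable ℝ f := hf.differentiable (by norm_num)
  have h1 : ∀ t : ℝ, fderiv ℝ f (x + t • v) v
      = a₁ + 2 * a₂ * t + 3 * a₃ * t ^ 2 + 4 * a₄ * t ^ 3 := by
    intro t
    have e1 : HasDerivAt (fun t : ℝ => f (x + t • v)) (fderiv ℝ f (x + t • v) v) t :=
      (hd (x + t • v)).hasFDerivAt.comp_hasDerivAt t (hline t)
    have e2 : HasDerivAt (fun t : ℝ => a₀ + a₁ * t + a₂ * t ^ 2 + a₃ * t ^ 3 + a₄ * t ^ 4)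
        (a₁ + 2 * a₂ * t + 3 * a₃ * t ^ 2 + 4 * a₄ * t ^ 3) t := by
      refine ((((((hasDerivAt_id' t).const_mul a₁).const_add a₀).fun_add
        ((hasDerivAt_pow 2 t).const_mul a₂)).fun_add ((hasDerivAt_pow 3 t).const_mul a₃)).fun_add
        ((hasDerivAt_pow 4 t).const_mul a₄)).congr_deriv ?_
      norm_num
      ring
    rw [funext h] at e1
    exact e1.unique e2
  refine ⟨by simpa using h1 0, ?_⟩
  rw [iteratedFDeriv_two_apply]
  have hd2 : Differentiable ℝ (fderiv ℝ f) :=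
    (hf.fderiv_right (m := 1) (by norm_num)).differentiable (by norm_num)
  have e1 : HasDerivAt (fun t : ℝ => fderiv ℝ f (x + t • v) v)
      (fderiv ℝ (fderiv ℝ f) x v v) 0 := by
    have h0 : HasFDerivAt (fun y => fderiv ℝ f y v)
        ((ContinuousLinearMap.apply ℝ ℝ v).comp (fderiv ℝ (fderiv ℝ f) x)) x :=
      (ContinuousLinearMap.apply ℝ ℝ v).hasFDerivAt.comp x (hd2 x).hasFDerivAt
    exact h0.comp_hasDerivAt_of_eq (0 : ℝ) (hline 0) (by simp)
  have e2 : HasDerivAt (fun t : ℝ => a₁ + 2 * a₂ * t + 3 * a₃ * t ^ 2 + 4 * a₄ * t ^ 3)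
      (2 * a₂) 0 := by
    refine (((((hasDerivAt_id' (0 : ℝ)).const_mul (2 * a₂)).const_add a₁).fun_add
      ((hasDerivAt_pow 2 (0 : ℝ)).const_mul (3 * a₃))).fun_add
      ((hasDerivAt_pow 3 (0 : ℝ)).const_mul (4 * a₄))).congr_deriv ?_
    norm_num
  rw [funext h1] at e1
  exact e1.unique e2

variable {𝕜 : Type*} [RCLike 𝕜]

open RCLike

/-- The quadratic form of a matrix. -/
noncomputable def quadForm {d : ℕ} (A : Matrix (Fin d) (Fin d) 𝕜)
    (x y : EuclideanSpace 𝕜 (Fin d)) : ℝ :=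
  re (inner 𝕜 x (Matrix.toEuclideanCLM (n := Fin d) (𝕜 := 𝕜) A y))

theorem inner_toEuclideanCLM {d : ℕ} (A : Matrix (Fin d) (Fin d) 𝕜)
    (x y : EuclideanSpace 𝕜 (Fin d)) :
    inner 𝕜 x (Matrix.toEuclideanCLM (n := Fin d) (𝕜 := 𝕜) A y)
      = ∑ i, ∑ j, star (x i) * A i j * y j := by
  simp [PiLp.inner_apply, Matrix.mulVec, dotProduct, Matrix.ofLp_toEuclideanCLM, Finset.sum_mul,
    RCLike.inner_apply]
  refine Finset.sum_congr rfl fun i _ => Finset.sum_congr rfl fun j _ => by ring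

theorem trace_conjTranspose_mul_outer {d : ℕ} {A : Matrix (Fin d) (Fin d) 𝕜} (hA : A.IsHermitian)
    (x : EuclideanSpace 𝕜 (Fin d)) :
    re (A.conjTranspose * outer x.ofLp).trace = quadForm A x x := by
  rw [quadForm, inner_toEuclideanCLM, hA.eq]
  congr 1
  simp only [Matrix.trace, Matrix.diag_apply, Matrix.mul_apply, outer, Matrix.vecMulVec_apply,
    Pi.star_apply]
  refine Finset.sum_congr rfl fun i _ => Finset.sum_congr rfl fun j _ => by ring

theorem quadForm_comm {d : ℕ} {A : Matrix (Fin d) (Fin d) 𝕜} (hA : A.IsHermitian)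
    (x y : EuclideanSpace 𝕜 (Fin d)) : quadForm A x y = quadForm A y x := by
  rw [quadForm, quadForm, inner_toEuclideanCLM, inner_toEuclideanCLM, ← RCLike.conj_re]
  congr 1
  simp only [map_sum, map_mul, RCLike.star_def, RCLike.conj_conj]
  rw [Finset.sum_comm]
  refine Finset.sum_congr rfl fun i _ => Finset.sum_congr rfl fun j _ => ?_
  have := hA.apply i j
  rw [RCLike.star_def] at this
  rw [this]; ring

theorem quadForm_add_smul {d : ℕ} {A : Matrix (Fin d) (Fin d) 𝕜} (hA : A.IsHermitian)
    (x v : EuclideanSpace 𝕜 (Fin d)) (t : ℝ) :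
    quadForm A (x + t • v) (x + t • v)
      = quadForm A x x + 2 * quadForm A v x * t + quadForm A v v * t ^ 2 := by
  have h := quadForm_comm hA x v
  have e : ∀ w : EuclideanSpace 𝕜 (Fin d), t • w = (t : 𝕜) • w := fun w => by
    rw [← RCLike.real_smul_eq_coe_smul]
  simp only [quadForm] at *
  rw [e]
  simp only [map_add, map_smul, inner_add_left, inner_add_right, inner_smul_left, inner_smul_right,
    RCLike.conj_ofReal, RCLike.re_ofReal_mul, h]
  ring

theorem quadForm_smul_smul {d : ℕ} (A : Matrix (Fin d) (Fin d) 𝕜)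
    (x : EuclideanSpace 𝕜 (Fin d)) (s : 𝕜) :
    quadForm A (s • x) (s • x) = ‖s‖ ^ 2 * quadForm A x x := by
  simp only [quadForm, map_smul, inner_smul_left, inner_smul_right]
  rw [← mul_assoc, RCLike.mul_conj, ← RCLike.ofReal_pow, RCLike.re_ofReal_mul]

/-- The quadratic polynomial t ↦ q(x + tv) is nonnegative, so its discriminant is not positive. This
is the only way positive semidefiniteness enters the landscape argument. -/
theorem quadForm_sq_le {d : ℕ} {A : Matrix (Fin d) (Fin d) 𝕜} (hA : A.IsHermitian)
    (hp : ∀ x : EuclideanSpace 𝕜 (Fin d), 0 ≤ quadForm A x x) (x v : EuclideanSpace 𝕜 (Fin d)) :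
    quadForm A v x ^ 2 ≤ quadForm A x x * quadForm A v v := by
  have := discrim_le_zero (a := quadForm A v v) (b := 2 * quadForm A v x) (c := quadForm A x x)
    (fun t => by
      have := hp (x + t • v)
      rw [quadForm_add_smul hA] at this
      nlinarith)
  rw [discrim] at this
  nlinarith

theorem objective_eq {d n : ℕ} {A : Fin n → Matrix (Fin d) (Fin d) 𝕜}
    (hA : ∀ i, (A i).IsHermitian) (xs x : EuclideanSpace 𝕜 (Fin d)) :
    objective A (measOp A (outer xs.ofLp)) x
      = ∑ i, (quadForm (A i) x x - quadForm (A i) xs xs) ^ 2 := by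
  rw [objective, EuclideanSpace.norm_sq_eq]
  refine Finset.sum_congr rfl fun i _ => ?_
  simp only [measOp, PiLp.sub_apply, trace_conjTranspose_mul_outer (hA i), Real.norm_eq_abs, sq_abs]
  ring

theorem norm_sq_measOp_sub {d n : ℕ} {A : Fin n → Matrix (Fin d) (Fin d) 𝕜}
    (hA : ∀ i, (A i).IsHermitian) (xs x : EuclideanSpace 𝕜 (Fin d)) :
    ‖measOp A (outer x.ofLp - outer xs.ofLp)‖ ^ 2
      = ∑ i, (quadForm (A i) x x - quadForm (A i) xs xs) ^ 2 := by
  rw [EuclideanSpace.norm_sq_eq]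
  refine Finset.sum_congr rfl fun i _ => ?_
  simp only [measOp, mul_sub, Matrix.trace_sub, map_sub, trace_conjTranspose_mul_outer (hA i),
    Real.norm_eq_abs, sq_abs]

theorem contDiff_objective {d n : ℕ} {A : Fin n → Matrix (Fin d) (Fin d) 𝕜}
    (hA : ∀ i, (A i).IsHermitian) (xs : EuclideanSpace 𝕜 (Fin d)) :
    ContDiff ℝ 2 (objective A (measOp A (outer xs.ofLp))) := by
  rw [funext (objective_eq hA xs)]
  refine ContDiff.sum fun i _ => ContDiff.pow (ContDiff.sub ?_ contDiff_const) 2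
  have h1 : ContDiff ℝ 2 fun x : EuclideanSpace 𝕜 (Fin d) =>
      Matrix.toEuclideanCLM (n := Fin d) (𝕜 := 𝕜) (A i) x :=
    ((Matrix.toEuclideanCLM (n := Fin d) (𝕜 := 𝕜) (A i)).restrictScalars ℝ).contDiff
  exact (RCLike.reCLM (K := 𝕜)).contDiff.comp (contDiff_id.inner 𝕜 h1)

/-- The first and second order conditions in terms of the quadratic forms of the measurements. -/
theorem IsSecondOrderCritical.conditions {d n : ℕ} {A : Fin n → Matrix (Fin d) (Fin d) 𝕜}
    (hA : ∀ i, (A i).IsHermitian) {xs x : EuclideanSpace 𝕜 (Fin d)}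
    (hx : IsSecondOrderCritical (objective A (measOp A (outer xs.ofLp))) x)
    (v : EuclideanSpace 𝕜 (Fin d)) :
    ∑ i, (quadForm (A i) x x - quadForm (A i) xs xs) * quadForm (A i) v x = 0 ∧
    0 ≤ ∑ i, (2 * quadForm (A i) v x ^ 2
      + (quadForm (A i) x x - quadForm (A i) xs xs) * quadForm (A i) v v) := by
  set h : Fin n → ℝ := fun i => quadForm (A i) x x - quadForm (A i) xs xs with hh
  set b : Fin n → ℝ := fun i => quadForm (A i) v x
  set c : Fin n → ℝ := fun i => quadForm (A i) v v
  -- Along x + tv each residual is h + 2bt + ct²; the five sums are the coefficients of Σ (h + 2bt +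
  -- ct²)².
  obtain ⟨h1, h2⟩ := derivatives_of_quartic_on_line (contDiff_objective hA xs) x v
    (∑ i, h i ^ 2) (∑ i, 4 * (h i * b i)) (∑ i, 2 * (2 * b i ^ 2 + h i * c i))
    (∑ i, 4 * (b i * c i)) (∑ i, c i ^ 2) (fun t => by
      rw [objective_eq hA]
      simp only [Finset.sum_mul, ← Finset.sum_add_distrib]
      refine Finset.sum_congr rfl fun i _ => ?_
      rw [quadForm_add_smul (hA i)]
      simp only [hh, b, c]
      ring)
  have h3 := hx.2 v
  rw [h2, ← Finset.mul_sum] at h3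
  rw [hx.1, ← Finset.mul_sum] at h1
  simp at h1
  exact ⟨h1, by linarith⟩

theorem quadForm_measAdj {d n : ℕ} {A : Fin n → Matrix (Fin d) (Fin d) 𝕜}
    (hA : ∀ i, (A i).IsHermitian) (xs v : EuclideanSpace 𝕜 (Fin d)) :
    quadForm (measAdj A (measOp A (outer xs.ofLp))) v v
      = ∑ i, quadForm (A i) xs xs * quadForm (A i) v v := by
  have : ∀ i, quadForm (A i) xs xs * quadForm (A i) v v
      = quadForm (quadForm (A i) xs xs • A i) v v := fun i => by
    simp only [quadForm, inner_toEuclideanCLM, Matrix.smul_apply]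
    rw [← RCLike.re_ofReal_mul]
    congr 1
    simp only [Finset.mul_sum, RCLike.real_smul_eq_coe_mul]
    refine Finset.sum_congr rfl fun i _ => Finset.sum_congr rfl fun j _ => by ring
  simp only [this, measAdj, measOp, trace_conjTranspose_mul_outer (hA _)]
  simp only [quadForm, map_sum, sum_apply, inner_sum]

theorem quadForm_le_opNorm {d : ℕ} (M : Matrix (Fin d) (Fin d) 𝕜) (v : EuclideanSpace 𝕜 (Fin d)) :
    quadForm M v v ≤ opNorm M * ‖v‖ ^ 2 := by
  calc quadForm M v v ≤ ‖v‖ * ‖Matrix.toEuclideanCLM (n := Fin d) (𝕜 := 𝕜) M v‖ :=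
        re_inner_le_norm _ _
    _ ≤ ‖v‖ * (opNorm M * ‖v‖) := by
        gcongr
        exact ContinuousLinearMap.le_opNorm _ _
    _ = _ := by ring

/-- Expansion of the square, with tr(xx^* yy^*) = |⟨x,y⟩|². It reduces the isometry condition to
three scalars, ‖x‖², ‖y‖² and |⟨x,y⟩|². -/
theorem frobNorm_sq_outer_sub {d : ℕ} (x y : EuclideanSpace 𝕜 (Fin d)) :
    frobNorm (outer x.ofLp - outer y.ofLp) ^ 2
      = (‖x‖ ^ 2) ^ 2 + (‖y‖ ^ 2) ^ 2 - 2 * ‖inner 𝕜 x y‖ ^ 2 := by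
  rw [frobNorm, Real.sq_sqrt (by positivity)]
  have key : ∀ a b c e : 𝕜, ‖a * star b - c * star e‖ ^ 2
      = ‖a‖ ^ 2 * ‖b‖ ^ 2 + ‖c‖ ^ 2 * ‖e‖ ^ 2 - 2 * re ((star a * c) * star (star b * e)) := by
    intro a b c e
    have h : ∀ z w : 𝕜, ‖z - w‖ ^ 2 = ‖z‖ ^ 2 + ‖w‖ ^ 2 - 2 * re (star z * w) := by
      intro z w
      have := norm_sub_sq (𝕜 := 𝕜) z w
      rw [RCLike.inner_apply'] at this
      rw [this]; simp only [RCLike.star_def]; ring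
    rw [h]
    simp only [norm_mul, norm_star, mul_pow]
    congr 3
    simp only [star_mul, star_star]; ring
  simp only [outer, Matrix.sub_apply, Matrix.vecMulVec_apply, Pi.star_apply, key,
    Finset.sum_sub_distrib, Finset.sum_add_distrib, ← Finset.mul_sum, ← Finset.sum_mul, ← map_sum,
    ← star_sum]
  rw [EuclideanSpace.norm_sq_eq, EuclideanSpace.norm_sq_eq]
  have : inner 𝕜 x y = ∑ i, star (x i) * y i := by
    simp [PiLp.inner_apply, mul_comm]
  rw [this]
  generalize ∑ i, star (x i) * y i = z
  rw [RCLike.star_def, RCLike.mul_conj, ← RCLike.ofReal_pow, RCLike.ofReal_re]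
  ring

theorem outer_eq_of_frobNorm {d : ℕ} {x y : EuclideanSpace 𝕜 (Fin d)}
    (h : frobNorm (outer x.ofLp - outer y.ofLp) ^ 2 ≤ 0) : outer x.ofLp = outer y.ofLp := by
  rw [frobNorm, Real.sq_sqrt (by positivity)] at h
  have h0 := le_antisymm h (by positivity)
  rw [Finset.sum_eq_zero_iff_of_nonneg (fun i _ => by positivity)] at h0
  ext i j
  have := h0 i (Finset.mem_univ _)
  rw [Finset.sum_eq_zero_iff_of_nonneg (fun i _ => by positivity)] at this
  have := this j (Finset.mem_univ _)
  simpa [sub_eq_zero] using this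

theorem exists_phase_of_outer_eq {d : ℕ} {x y : EuclideanSpace 𝕜 (Fin d)}
    (h : outer x.ofLp = outer y.ofLp) : ∃ s : 𝕜, ‖s‖ = 1 ∧ x = s • y := by
  have e : ∀ i j, x i * star (x j) = y i * star (y j) := fun i j => by
    have := congrFun (congrFun h i) j
    simpa [outer, Matrix.vecMulVec_apply] using this
  have hn : ∀ i, ‖x i‖ = ‖y i‖ := fun i => by
    have := congrArg norm (e i i)
    simp only [norm_mul, norm_star] at this
    nlinarith [norm_nonneg (x i), norm_nonneg (y i), mul_self_nonneg (‖x i‖ - ‖y i‖),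
      abs_eq_abs.1 (sq_eq_sq_iff_abs_eq_abs (‖x i‖) (‖y i‖) |>.1 (by nlinarith))]
  by_cases hy : y = 0
  · refine ⟨1, by simp, ?_⟩
    ext i
    have := hn i
    simp [hy] at this
    simp [hy, this]
  · obtain ⟨j, hj⟩ : ∃ j, y j ≠ 0 := by
      by_contra! hc
      exact hy (by ext i; simp [hc i])
    have hxj : x j ≠ 0 := by
      rw [← norm_ne_zero_iff, hn, norm_ne_zero_iff]; exact hj
    -- Column j reads x_i conj(x_j) = y_i conj(y_j); dividing by conj(x_j) exhibits the phase.
    refine ⟨star (y j) / star (x j), by simp [hn, hj], ?_⟩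
    ext i
    have hs : star (x j) ≠ 0 := by simpa using hxj
    simp only [PiLp.smul_apply, smul_eq_mul]
    field_simp
    rw [e]; ring

open scoped ComplexOrder in
theorem quadForm_self_nonneg {d : ℕ} {A : Matrix (Fin d) (Fin d) 𝕜} (hA : A.PosSemidef)
    (x : EuclideanSpace 𝕜 (Fin d)) : 0 ≤ quadForm A x x := by
  have := hA.re_dotProduct_nonneg x.ofLp
  convert this using 1
  rw [quadForm, inner_toEuclideanCLM]
  congr 1
  simp only [dotProduct, Matrix.mulVec, Finset.mul_sum, Pi.star_apply]
  refine Finset.sum_congr rfl fun i _ => Finset.sum_congr rfl fun j _ => by ring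

/-- The scalar core of the landscape argument: r = ‖x‖², R = ‖x_*‖², D = ‖v‖² for the component v of
x_* orthogonal to x, g = |⟨x,x_*⟩|², and S is the mean squared residual. The Hessian bounds S above
by a multiple of RD; `hgap` bounds RD above by the isometry bracket, hence by S. The constants are
strictly incompatible unless RD = 0. -/
theorem gap_arithmetic {m δL δU r R D g S : ℝ} (hm : 0 < m) (hL : 0 < δL) (hU : 0 < δU)
    (hadm : 3 * (m ^ 2 + 2 * m) * δL + 2 * (m + 1) * δU < m ^ 2 + 2 * m - 2)
    (hr0 : 0 ≤ r) (hR0 : 0 ≤ R) (hD0 : 0 ≤ D) (hg0 : 0 ≤ g) (horth : r * D = r * R - g)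
    (hr : r = 0 → D = R) (hS : 3 * S ≤ 2 * ((1 + m + δU) * R * D))
    (hlow : (1 - δL) * (m * (r ^ 2 + R ^ 2 - 2 * g) + (r - R) ^ 2) ≤ S) :
    r ^ 2 + R ^ 2 - 2 * g ≤ 0 := by
  have hL1 : 0 < 1 - δL := by nlinarith [mul_pos hm hm, mul_pos hm hL]
  have hgap : m * (m + 2) * (R * D) ≤ (m + 1) * (m * (r ^ 2 + R ^ 2 - 2 * g) + (r - R) ^ 2) := by
    -- For r = 0 the relation `horth` says nothing about D, so that case needs `hr`.
    rcases hr0.eq_or_lt with h0 | h0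
    · rw [hr h0.symm]
      have hg : g = 0 := by rw [← h0] at horth; linarith
      rw [hg, ← h0]
      nlinarith [mul_nonneg hR0 hR0]
    · have hDR : D ≤ R := by
        have : r * D ≤ r * R := by linarith
        exact le_of_mul_le_mul_left this h0
      have hgg : g = r * (R - D) := by linarith
      have h1 : 0 ≤ m ^ 2 * (D * (R - D)) :=
        mul_nonneg (by positivity) (mul_nonneg hD0 (sub_nonneg.2 hDR))
      -- With g = r(R - D), the difference of the two sides is a quadratic in r; this is its
      -- completed square, and `h1` is the remainder.
      have h2 := sq_nonneg ((m + 1) * r - R - m * (R - D))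
      have h3 : (m + 1) * (m * (r ^ 2 + R ^ 2 - 2 * g) + (r - R) ^ 2) - m * (m + 2) * (R * D)
          = ((m + 1) * r - R - m * (R - D)) ^ 2 + m ^ 2 * (D * (R - D)) := by
        rw [hgg]; ring
      linarith
  have h1 : (1 - δL) * (m * (m + 2) * (R * D)) ≤ (m + 1) * S := by
    calc (1 - δL) * (m * (m + 2) * (R * D))
        ≤ (1 - δL) * ((m + 1) * (m * (r ^ 2 + R ^ 2 - 2 * g) + (r - R) ^ 2)) := by gcongr
      _ = (m + 1) * ((1 - δL) * (m * (r ^ 2 + R ^ 2 - 2 * g) + (r - R) ^ 2)) := by ring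
      _ ≤ _ := by gcongr
  have hRD : R * D = 0 := by
    have h2 : (3 * (1 - δL) * (m * (m + 2)) - 2 * (m + 1) * (1 + m + δU)) * (R * D) ≤ 0 := by
      have : (m + 1) * (3 * S) ≤ (m + 1) * (2 * ((1 + m + δU) * R * D)) := by gcongr
      linarith
    -- A rearrangement of `hadm`: 3m(m + 2) - 2(m + 1)² = m² + 2m - 2.
    have h3 : 0 < 3 * (1 - δL) * (m * (m + 2)) - 2 * (m + 1) * (1 + m + δU) := by linarith
    have h4 : R * D ≤ 0 := by
      by_contra! hc
      linarith [mul_pos h3 hc]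
    exact le_antisymm h4 (by positivity)
  have hS0 : S ≤ 0 := by
    have : (1 + m + δU) * R * D = 0 := by rw [mul_assoc, hRD, mul_zero]
    linarith
  have h6 : m * (r ^ 2 + R ^ 2 - 2 * g) + (r - R) ^ 2 ≤ 0 := by
    by_contra! hc
    linarith [mul_pos hL1 hc]
  by_contra! hc
  linarith [mul_pos hm hc, sq_nonneg (r - R)]

/-- Every second-order critical point recovers the signal up to a phase. -/
theorem landscape {d n : ℕ} {A : Fin n → Matrix (Fin d) (Fin d) 𝕜}
    {xs : EuclideanSpace 𝕜 (Fin d)} {m δL δU : ℝ} (hA : ∀ i, (A i).IsHermitian)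
    (hp : ∀ i (x : EuclideanSpace 𝕜 (Fin d)), 0 ≤ quadForm (A i) x x)
    (hc : AdmissibleConstants m δL δU) (hM : MeasurementCondition A xs m δL δU)
    {x : EuclideanSpace 𝕜 (Fin d)}
    (hx : IsSecondOrderCritical (objective A (measOp A (outer xs.ofLp))) x) :
    outer x.ofLp = outer xs.ofLp := by
  obtain ⟨hm, hL, hU, hadm⟩ := hc
  obtain ⟨hup, hlow⟩ := hM
  have hn : 0 ≤ 1 / (n : ℝ) := by positivity
  -- decompose the signal along `x` and its orthogonal complement
  set α : 𝕜 := inner 𝕜 x xs / ((‖x‖ ^ 2 : ℝ) : 𝕜) with hα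
  set v := xs - α • x with hv
  set h : Fin n → ℝ := fun i => quadForm (A i) x x - quadForm (A i) xs xs with hh
  -- Expand x_* = v + αx. The cross term is the derivative in the direction conj(α)v and the last
  -- term the derivative in the direction x, so stationarity kills both.
  have hqv : ∑ i, h i * quadForm (A i) v v = ∑ i, h i * quadForm (A i) xs xs := by
    have e1 := (hx.conditions hA (star α • v)).1
    have e2 := (hx.conditions hA x).1
    have : ∀ i, h i * quadForm (A i) xs xs = h i * quadForm (A i) v v
        + 2 * (h i * quadForm (A i) (star α • v) x) + ‖α‖ ^ 2 * (h i * quadForm (A i) x x) := by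
      intro i
      have e3 : xs = v + (1 : ℝ) • (α • x) := by simp [hv]
      have e4 : quadForm (A i) (α • x) v = quadForm (A i) (star α • v) x := by
        rw [quadForm_comm (hA i)]
        simp only [quadForm, map_smul, inner_smul_left, inner_smul_right, RCLike.star_def,
          RCLike.conj_conj]
      conv_lhs => rw [e3]
      rw [quadForm_add_smul (hA i), e4, quadForm_smul_smul]
      ring
    rw [Finset.sum_congr rfl fun i _ => this i, Finset.sum_add_distrib, Finset.sum_add_distrib,
      ← Finset.mul_sum, ← Finset.mul_sum, e1, e2]
    ring
  have hqs : ∑ i, h i * quadForm (A i) xs xs = - ∑ i, h i ^ 2 := by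
    have e2 := (hx.conditions hA x).1
    have : ∀ i, h i * quadForm (A i) xs xs = h i * quadForm (A i) x x - h i ^ 2 := fun i => by
      simp only [hh]; ring
    rw [Finset.sum_congr rfl fun i _ => this i, Finset.sum_sub_distrib, e2]
    ring
  -- Cauchy–Schwarz gives 2q(v,x)² ≤ 2q(x)q(v), and q(x) = q(x_*) + h adds two copies of h q(v) to
  -- the one already in the Hessian: hence the 3.
  have hess : 3 * ∑ i, h i ^ 2 ≤ 2 * ∑ i, quadForm (A i) xs xs * quadForm (A i) v v := by
    have e1 := (hx.conditions hA v).2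
    have e2 : ∑ i, (2 * quadForm (A i) v x ^ 2 + h i * quadForm (A i) v v)
        ≤ ∑ i, (2 * (quadForm (A i) xs xs * quadForm (A i) v v)
          + 3 * (h i * quadForm (A i) v v)) := by
      refine Finset.sum_le_sum fun i _ => ?_
      have := quadForm_sq_le (hA i) (hp i) x v
      simp only [hh]
      nlinarith
    rw [Finset.sum_add_distrib (f := fun i => 2 * (quadForm (A i) xs xs * quadForm (A i) v v)),
      ← Finset.mul_sum, ← Finset.mul_sum, hqv, hqs] at e2
    linarith
  have hlowx := hlow x
  rw [norm_sq_measOp_sub hA, frobNorm_sq_outer_sub] at hlowx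
  rw [← quadForm_measAdj hA] at hess
  have hop := quadForm_le_opNorm (measAdj A (measOp A (outer xs.ofLp))) v
  have horth : ‖x‖ ^ 2 * ‖v‖ ^ 2 = ‖x‖ ^ 2 * ‖xs‖ ^ 2 - ‖inner 𝕜 x xs‖ ^ 2 := by
    by_cases hx0 : x = 0
    · simp [hx0]
    have hx1 : ‖x‖ ^ 2 ≠ 0 := by simpa using hx0
    have e := norm_sub_sq (𝕜 := 𝕜) xs (α • x)
    rw [← hv, inner_smul_right, norm_smul, mul_pow, hα, norm_div, RCLike.norm_ofReal,
      abs_of_nonneg (by positivity), div_mul_eq_mul_div, ← inner_conj_symm xs x, RCLike.mul_conj,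
      ← RCLike.ofReal_pow, ← RCLike.ofReal_div, RCLike.ofReal_re] at e
    rw [e]
    field_simp
    ring
  have hvle : x = 0 → ‖v‖ ^ 2 = ‖xs‖ ^ 2 := fun h0 => by simp [hv, h0]
  have hS : (1 / (n : ℝ)) * (3 * ∑ i, h i ^ 2) ≤ 2 * ((1 + m + δU) * ‖xs‖ ^ 2 * ‖v‖ ^ 2) := by
    calc (1 / (n : ℝ)) * (3 * ∑ i, h i ^ 2)
        ≤ (1 / (n : ℝ)) * (2 * (opNorm (measAdj A (measOp A (outer xs.ofLp))) * ‖v‖ ^ 2)) := by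
          refine mul_le_mul_of_nonneg_left ?_ hn
          linarith
      _ = 2 * ((1 / (n : ℝ) * opNorm (measAdj A (measOp A (outer xs.ofLp)))) * ‖v‖ ^ 2) := by ring
      _ ≤ _ := by gcongr
  set S := (1 / (n : ℝ)) * ∑ i, h i ^ 2 with hSdef
  have hS' : 3 * S ≤ 2 * ((1 + m + δU) * ‖xs‖ ^ 2 * ‖v‖ ^ 2) := by
    calc 3 * S = (1 / (n : ℝ)) * (3 * ∑ i, h i ^ 2) := by rw [hSdef]; ring
      _ ≤ _ := hS
  have hr1 : ‖x‖ ^ 2 = 0 → ‖v‖ ^ 2 = ‖xs‖ ^ 2 := fun h0 => hvle (by simpa using h0)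
  refine outer_eq_of_frobNorm ?_
  rw [frobNorm_sq_outer_sub]
  exact gap_arithmetic hm hL hU hadm (by positivity) (by positivity) (by positivity)
    (by positivity) horth hr1 hS' hlowx

end Deterministic

/-! ### Moments of isotropic Gaussian vectors, real and complex. -/

section Gaussian

open RCLike
open scoped NNReal

theorem integrable_pow_gaussianReal (v : ℝ≥0) (n : ℕ) :
    Integrable (fun x : ℝ => x ^ n) (gaussianReal 0 v) := by
  have := (memLp_id_gaussianReal (μ := 0) (v := v) (n : ℝ≥0)).integrable_norm_pow'
  refine this.mono' (by fun_prop) (Filter.Eventually.of_forall fun x => ?_)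
  simp

/-- Four derivatives at 0 of the moment generating function exp(vt²/2). Each has the form p(t)
exp(vt²/2), and `step` is the recursion p ↦ p' + vtp. -/
theorem integral_pow_four_gaussianReal (v : ℝ≥0) :
    ∫ x, x ^ 4 ∂(gaussianReal 0 v) = 3 * (v : ℝ) ^ 2 := by
  set μ := gaussianReal 0 v
  have hint : ∀ t : ℝ, t ∈ interior (integrableExpSet (fun x : ℝ => x) μ) := fun t => by
    rw [integrableExpSet_fun_id_gaussianReal]; simp
  have key : ∀ n t, HasDerivAt (fun t => ∫ x, x ^ n * Real.exp (t * x) ∂μ)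
      (∫ x, x ^ (n + 1) * Real.exp (t * x) ∂μ) t := fun n t =>
    hasDerivAt_integral_pow_mul_exp_real (hint t) n
  have e0 : ∀ t, ∫ x, x ^ 0 * Real.exp (t * x) ∂μ = Real.exp (v * t ^ 2 / 2) := fun t => by
    have := congrFun (mgf_fun_id_gaussianReal (μ := 0) (v := v)) t
    simpa [mgf] using this
  have hexp : ∀ t : ℝ, HasDerivAt (fun t : ℝ => Real.exp (v * t ^ 2 / 2))
      (Real.exp (v * t ^ 2 / 2) * (v * t)) t := fun t => by
    have h := ((hasDerivAt_pow 2 t).const_mul (v : ℝ)).div_const 2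
    refine h.exp.congr_deriv ?_
    norm_num
    ring_nf
  have step : ∀ (n : ℕ) (p p' : ℝ → ℝ), (∀ t, HasDerivAt p (p' t) t) →
      (∀ t, ∫ x, x ^ n * Real.exp (t * x) ∂μ = p t * Real.exp (v * t ^ 2 / 2)) →
      ∀ t, ∫ x, x ^ (n + 1) * Real.exp (t * x) ∂μ
        = (p' t + p t * (v * t)) * Real.exp (v * t ^ 2 / 2) := by
    intro n p p' hp h t
    have h1 := key n t
    rw [funext h] at h1
    rw [h1.unique ((hp t).fun_mul (hexp t))]
    ring
  have e1 := step 0 (fun _ => 1) (fun _ => 0) (fun t => hasDerivAt_const t 1)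
    (fun t => by rw [e0]; ring)
  have e2 := step 1 (fun t => v * t) (fun _ => v)
    (fun t => ((hasDerivAt_id' t).const_mul (v : ℝ)).congr_deriv (by ring))
    (fun t => by rw [e1]; ring)
  have e3 := step 2 (fun t => v + (v : ℝ) ^ 2 * t ^ 2) (fun t => 2 * (v : ℝ) ^ 2 * t)
    (fun t => (((hasDerivAt_pow 2 t).const_mul ((v : ℝ) ^ 2)).const_add (v : ℝ)).congr_deriv
      (by norm_num; ring))
    (fun t => by rw [e2]; ring)
  have e4 := step 3 (fun t => 3 * (v : ℝ) ^ 2 * t + (v : ℝ) ^ 3 * t ^ 3)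
    (fun t => 3 * (v : ℝ) ^ 2 + 3 * (v : ℝ) ^ 3 * t ^ 2)
    (fun t => (((hasDerivAt_id' t).const_mul (3 * (v : ℝ) ^ 2)).fun_add
      ((hasDerivAt_pow 3 t).const_mul ((v : ℝ) ^ 3))).congr_deriv (by norm_num; ring))
    (fun t => by rw [e3]; ring)
  simpa using e4 0

/-- The exponential moment of the square of a Gaussian variable at half the critical exponent. -/
theorem exp_sq_gaussianReal {v : ℝ≥0} (hv : v ≠ 0) :
    Integrable (fun x : ℝ => Real.exp (x ^ 2 / (4 * v))) (gaussianReal 0 v) ∧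
      ∫ x, Real.exp (x ^ 2 / (4 * v)) ∂(gaussianReal 0 v) = √2 := by
  have hv' : (0 : ℝ) < v := by positivity
  have e : ∀ x : ℝ, gaussianPDFReal 0 v x * Real.exp (x ^ 2 / (4 * v))
      = (√(2 * Real.pi * v))⁻¹ * Real.exp (-(1 / (4 * v)) * x ^ 2) := fun x => by
    rw [gaussianPDFReal, mul_assoc, ← Real.exp_add]
    congr 2
    field_simp
    ring
  constructor
  · rw [gaussianReal_of_var_ne_zero _ hv, gaussianPDF_def,
      integrable_withDensity_iff_integrable_smul' (by fun_prop)
        (Filter.Eventually.of_forall fun _ => ENNReal.ofReal_lt_top)]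
    refine ((integrable_exp_neg_mul_sq (b := 1 / (4 * v)) (by positivity)).const_mul
      ((√(2 * Real.pi * v))⁻¹)).congr (Filter.Eventually.of_forall fun x => ?_)
    simp only
    rw [ENNReal.toReal_ofReal (gaussianPDFReal_nonneg _ _ _), smul_eq_mul, e]
  · rw [integral_gaussianReal_eq_integral_smul hv]
    simp only [smul_eq_mul, e]
    rw [integral_const_mul, integral_gaussian, ← Real.sqrt_inv, ← Real.sqrt_mul (by positivity)]
    congr 1
    have := Real.pi_pos
    field_simp
    norm_num

theorem hasLaw_sum_gaussianReal {Ω ι : Type*} [MeasurableSpace Ω] {P : Measure Ω}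
    [IsProbabilityMeasure P] {X : ι → Ω → ℝ} (hX : iIndepFun X P) (hm : ∀ i, Measurable (X i))
    {v : ι → ℝ≥0} (hv : ∀ i, HasLaw (X i) (gaussianReal 0 (v i)) P) (s : Finset ι) :
    HasLaw (fun ω => ∑ i ∈ s, X i ω) (gaussianReal 0 (∑ i ∈ s, v i)) P := by
  classical
  induction s using Finset.induction_on with
  | empty =>
    simp only [Finset.sum_empty, gaussianReal_zero_var]
    exact ⟨by fun_prop, by rw [Measure.map_const]; simp⟩
  | insert i s hi ih =>
    refine ⟨by fun_prop, ?_⟩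
    have hind := (hX.indepFun_finsetSum_of_notMem hm hi).symm
    have := gaussianReal_add_gaussianReal_of_indepFun hind (hv i).map_eq
      (by rw [← ih.map_eq]; congr 1; ext ω; simp)
    rw [add_zero] at this
    rw [Finset.sum_insert hi, ← this]
    congr 1
    ext ω
    simp [Finset.sum_insert hi]

variable {𝕜 : Type*} [RCLike 𝕜]

/-- Every real linear functional `Re ⟨·, u⟩` is centred Gaussian of variance `κ ‖u‖²`. -/
def IsIsotropicGaussian (𝕜 : Type*) [RCLike 𝕜] {E : Type*} [NormedAddCommGroup E]
    [InnerProductSpace 𝕜 E] [MeasurableSpace E] (κ : ℝ≥0) (μ : Measure E) : Prop :=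
  ∀ u : E, HasLaw (fun a => re (inner 𝕜 a u)) (gaussianReal 0 (κ * ‖u‖₊ ^ 2)) μ

theorem isIsotropicGaussian_stdReal : IsIsotropicGaussian ℝ 1 stdReal := by
  intro u
  have := gaussianReal_mul_const (HasLaw.id (μ := stdReal)) u
  convert this using 1
  · ext a; simp [mul_comm]
  · simp only [mul_zero]
    congr 1
    ext
    simp

theorem isIsotropicGaussian_stdComplex : IsIsotropicGaussian ℂ (1 / 2) stdComplex := by
  intro u
  have hmk : Measurable fun p : ℝ × ℝ => Complex.mk p.1 p.2 :=
    Complex.measurableEquivRealProd.symm.measurable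
  have hX : HasLaw (fun p : ℝ × ℝ => p.1 * u.re) (gaussianReal 0 (.mk (u.re ^ 2) (sq_nonneg _) * (1 / 2)))
      ((gaussianReal 0 (1 / 2)).prod (gaussianReal 0 (1 / 2))) := by
    have := gaussianReal_mul_const (X := Prod.fst)
      (P := (gaussianReal 0 (1 / 2)).prod (gaussianReal 0 (1 / 2)))
      (μ := 0) (v := 1 / 2) ⟨by fun_prop, Measure.map_fst_prod.trans (by simp)⟩ u.re
    simpa using this
  have hY : HasLaw (fun p : ℝ × ℝ => p.2 * u.im) (gaussianReal 0 (.mk (u.im ^ 2) (sq_nonneg _) * (1 / 2)))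
      ((gaussianReal 0 (1 / 2)).prod (gaussianReal 0 (1 / 2))) := by
    have := gaussianReal_mul_const (X := Prod.snd)
      (P := (gaussianReal 0 (1 / 2)).prod (gaussianReal 0 (1 / 2)))
      (μ := 0) (v := 1 / 2) ⟨by fun_prop, Measure.map_snd_prod.trans (by simp)⟩ u.im
    simpa using this
  have hind : IndepFun (fun p : ℝ × ℝ => p.1 * u.re) (fun p : ℝ × ℝ => p.2 * u.im)
      ((gaussianReal 0 (1 / 2)).prod (gaussianReal 0 (1 / 2))) :=
    indepFun_prod (X := fun x : ℝ => x * u.re) (Y := fun x : ℝ => x * u.im)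
      (by fun_prop) (by fun_prop)
  have hsum := gaussianReal_add_gaussianReal_of_indepFun hind hX.map_eq hY.map_eq
  refine ⟨by fun_prop, ?_⟩
  rw [stdComplex, Measure.map_map (by fun_prop) hmk]
  convert hsum using 1
  · congr 1
    ext p
    simp [mul_comm]
  · rw [add_zero]
    congr 1
    ext
    simp only [NNReal.coe_mul, NNReal.coe_pow, coe_nnnorm, NNReal.coe_add,
      ← Complex.normSq_eq_norm_sq, Complex.normSq_apply]
    change _ = u.re ^ 2 * ((1 / 2 : ℝ≥0) : ℝ) + u.im ^ 2 * ((1 / 2 : ℝ≥0) : ℝ)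
    push_cast
    ring

/-- The coordinates contribute independent centred Gaussians whose variances κ|u_j|² add up to
κ‖u‖². -/
theorem IsIsotropicGaussian.pi {κ : ℝ≥0} [MeasurableSpace 𝕜] [BorelSpace 𝕜] {γ : Measure 𝕜}
    [IsProbabilityMeasure γ] (hγ : IsIsotropicGaussian 𝕜 κ γ) (d : ℕ) :
    IsIsotropicGaussian 𝕜 κ ((Measure.pi fun _ : Fin d => γ).map (WithLp.toLp 2)) := by
  intro u
  have hind : iIndepFun (fun (j : Fin d) (a : Fin d → 𝕜) => re (inner 𝕜 (a j) (u j)))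
      (Measure.pi fun _ : Fin d => γ) :=
    iIndepFun_pi (X := fun j z => re (inner 𝕜 z (u j))) fun j => (hγ (u j)).aemeasurable
  have hlaw : ∀ j : Fin d, HasLaw (fun a : Fin d → 𝕜 => re (inner 𝕜 (a j) (u j)))
      (gaussianReal 0 (κ * ‖u j‖₊ ^ 2)) (Measure.pi fun _ : Fin d => γ) := fun j =>
    (hγ (u j)).fun_comp (measurePreserving_eval (fun _ : Fin d => γ) j).hasLaw
  have h := hasLaw_sum_gaussianReal hind (fun j => by fun_prop) hlaw Finset.univ
  have hm : Measurable (WithLp.toLp 2 : (Fin d → 𝕜) → EuclideanSpace 𝕜 (Fin d)) := by fun_prop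
  refine ⟨by fun_prop, ?_⟩
  rw [Measure.map_map (by fun_prop) hm]
  convert h.map_eq using 2
  · ext a; simp [PiLp.inner_apply]
  · rw [← Finset.mul_sum]
    congr 1
    ext
    simp [EuclideanSpace.norm_sq_eq]

variable {E : Type*} [NormedAddCommGroup E] [InnerProductSpace 𝕜 E] [MeasurableSpace E]
  {κ : ℝ≥0} {μ : Measure E}

namespace IsIsotropicGaussian

theorem integrable_pow (h : IsIsotropicGaussian 𝕜 κ μ) (u : E) (n : ℕ) :
    Integrable (fun a => re (inner 𝕜 a u) ^ n) μ := by
  have := integrable_pow_gaussianReal (κ * ‖u‖₊ ^ 2) n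
  rw [← (h u).map_eq] at this
  exact this.comp_aemeasurable (h u).aemeasurable

theorem integral_pow_four (h : IsIsotropicGaussian 𝕜 κ μ) (u : E) :
    ∫ a, re (inner 𝕜 a u) ^ 4 ∂μ = 3 * κ ^ 2 * ‖u‖ ^ 4 := by
  have := (h u).integral_comp (f := fun x : ℝ => x ^ 4) (by fun_prop)
  simp only [Function.comp_def] at this
  rw [this, integral_pow_four_gaussianReal]
  push_cast
  ring

theorem integrable_sq_mul_sq (h : IsIsotropicGaussian 𝕜 κ μ) (x y : E) :
    Integrable (fun a => re (inner 𝕜 a x) ^ 2 * re (inner 𝕜 a y) ^ 2) μ := by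
  refine ((h.integrable_pow x 4).add (h.integrable_pow y 4)).mono'
    (((h x).aemeasurable.pow_const 2).mul ((h y).aemeasurable.pow_const 2)).aestronglyMeasurable
    (Filter.Eventually.of_forall fun a => ?_)
  rw [Real.norm_eq_abs, abs_of_nonneg (by positivity), Pi.add_apply]
  nlinarith [sq_nonneg (re (inner 𝕜 a x) ^ 2 - re (inner 𝕜 a y) ^ 2),
    sq_nonneg (re (inner 𝕜 a x) ^ 2), sq_nonneg (re (inner 𝕜 a y) ^ 2)]

/-- Polarization writes the product of two squares through fourth powers of single functionals, so
no joint law is needed. -/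
theorem integral_sq_mul_sq (h : IsIsotropicGaussian 𝕜 κ μ) (x y : E) :
    ∫ a, re (inner 𝕜 a x) ^ 2 * re (inner 𝕜 a y) ^ 2 ∂μ
      = κ ^ 2 * (‖x‖ ^ 2 * ‖y‖ ^ 2 + 2 * re (inner 𝕜 x y) ^ 2) := by
  have e : ∀ a, re (inner 𝕜 a x) ^ 2 * re (inner 𝕜 a y) ^ 2
      = (1 / 12) * (re (inner 𝕜 a (x + y)) ^ 4 + re (inner 𝕜 a (x - y)) ^ 4
        - 2 * re (inner 𝕜 a x) ^ 4 - 2 * re (inner 𝕜 a y) ^ 4) := fun a => by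
    simp only [inner_add_right, inner_sub_right, map_add, map_sub]; ring
  simp only [e]
  rw [integral_const_mul, integral_sub, integral_sub, integral_add, integral_const_mul,
    integral_const_mul, h.integral_pow_four, h.integral_pow_four, h.integral_pow_four,
    h.integral_pow_four]
  · have e1 := norm_add_sq (𝕜 := 𝕜) x y
    have e2 := norm_sub_sq (𝕜 := 𝕜) x y
    have e3 : ∀ z : E, ‖z‖ ^ 4 = (‖z‖ ^ 2) ^ 2 := fun z => by ring
    rw [e3, e3 (x - y), e1, e2]
    ring
  · exact h.integrable_pow _ 4
  · exact h.integrable_pow _ 4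
  · exact (h.integrable_pow _ 4).add (h.integrable_pow _ 4)
  · exact (h.integrable_pow _ 4).const_mul _
  · exact ((h.integrable_pow _ 4).add (h.integrable_pow _ 4)).sub ((h.integrable_pow _ 4).const_mul _)
  · exact (h.integrable_pow _ 4).const_mul _

theorem exp_sq (h : IsIsotropicGaussian 𝕜 κ μ) (hκ : κ ≠ 0) {u : E} (hu : ‖u‖ = 1) :
    Integrable (fun a => Real.exp (re (inner 𝕜 a u) ^ 2 / (4 * κ))) μ ∧
      ∫ a, Real.exp (re (inner 𝕜 a u) ^ 2 / (4 * κ)) ∂μ = √2 := by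
  have hu' : κ * ‖u‖₊ ^ 2 = κ := by
    have : ‖u‖₊ = 1 := by ext; simpa using hu
    simp [this]
  have hlaw := h u
  rw [hu'] at hlaw
  obtain ⟨h1, h2⟩ := exp_sq_gaussianReal hκ
  constructor
  · rw [← hlaw.map_eq] at h1
    exact h1.comp_aemeasurable hlaw.aemeasurable
  · rw [← h2]
    exact hlaw.integral_comp (f := fun x : ℝ => Real.exp (x ^ 2 / (4 * κ))) (by fun_prop)

end IsIsotropicGaussian

/-- The moment properties of isotropic Gaussian vectors used for concentration. -/
structure HasGaussianMoments (𝕜 : Type*) [RCLike 𝕜] {E : Type*} [NormedAddCommGroup E]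
    [InnerProductSpace 𝕜 E] [MeasurableSpace E] (μ : Measure E) (m : ℝ) : Prop where
  integrable_exp : ∀ u : E, ‖u‖ = 1 → Integrable (fun a => Real.exp (‖inner 𝕜 a u‖ ^ 2 / 4)) μ
  integral_exp_le : ∀ u : E, ‖u‖ = 1 → ∫ a, Real.exp (‖inner 𝕜 a u‖ ^ 2 / 4) ∂μ ≤ 2
  integral_mul : ∀ x y : E, ∫ a, ‖inner 𝕜 a x‖ ^ 2 * ‖inner 𝕜 a y‖ ^ 2 ∂μ
    = ‖x‖ ^ 2 * ‖y‖ ^ 2 + m * ‖inner 𝕜 x y‖ ^ 2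

theorem sqrt_two_le_two : √2 ≤ 2 := by
  rw [Real.sqrt_le_left (by norm_num)]; norm_num

theorem hasGaussianMoments_real {E : Type*} [NormedAddCommGroup E] [InnerProductSpace ℝ E]
    [MeasurableSpace E] {μ : Measure E} (h : IsIsotropicGaussian ℝ 1 μ) :
    HasGaussianMoments ℝ μ 2 where
  integrable_exp u hu := by simpa using (h.exp_sq one_ne_zero hu).1
  integral_exp_le u hu := by
    have := (h.exp_sq one_ne_zero hu).2
    simp only [re_to_real, NNReal.coe_one, mul_one] at this
    simp only [Real.norm_eq_abs, sq_abs, this]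
    exact sqrt_two_le_two
  integral_mul x y := by
    have := h.integral_sq_mul_sq x y
    simpa using this

/-- Everything reduces to real functionals, since |⟨a,u⟩|² is the sum of the squared real parts of
⟨a,u⟩ and ⟨a,iu⟩. -/
theorem hasGaussianMoments_complex {E : Type*} [NormedAddCommGroup E] [InnerProductSpace ℂ E]
    [MeasurableSpace E] {μ : Measure E} (h : IsIsotropicGaussian ℂ (1 / 2) μ) :
    HasGaussianMoments ℂ μ 1 := by
  have hI : ∀ u : E, ‖Complex.I • u‖ = ‖u‖ := fun u => by rw [norm_smul]; simp
  have hsq : ∀ a u : E, ‖inner ℂ a u‖ ^ 2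
      = re (inner ℂ a u) ^ 2 + re (inner ℂ a (Complex.I • u)) ^ 2 := fun a u => by
    rw [inner_smul_right, ← Complex.normSq_eq_norm_sq, Complex.normSq_apply]
    simp
    ring
  have hk : ((1 / 2 : ℝ≥0) : ℝ) = 1 / 2 := by simp
  have hexp : ∀ u : E, ‖u‖ = 1 → Integrable (fun a => 1 / 2 *
      (Real.exp (re (inner ℂ a u) ^ 2 / (4 * (1 / 2 : ℝ≥0)))
        + Real.exp (re (inner ℂ a (Complex.I • u)) ^ 2 / (4 * (1 / 2 : ℝ≥0))))) μ := fun u hu =>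
    ((h.exp_sq (by norm_num) hu).1.add
      (h.exp_sq (by norm_num) ((hI u).trans hu)).1).const_mul _
  -- The arithmetic–geometric mean inequality replaces independence of the two parts: it doubles the
  -- exponent, and at the variance 1/2 the result is exactly the moment of `exp_sq`.
  have hle : ∀ a u : E, Real.exp (‖inner ℂ a u‖ ^ 2 / 4) ≤ 1 / 2 *
      (Real.exp (re (inner ℂ a u) ^ 2 / (4 * (1 / 2 : ℝ≥0)))
        + Real.exp (re (inner ℂ a (Complex.I • u)) ^ 2 / (4 * (1 / 2 : ℝ≥0)))) := fun a u => by
    rw [hsq, hk]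
    set p := re (inner ℂ a u) ^ 2
    set q := re (inner ℂ a (Complex.I • u)) ^ 2
    have e1 : Real.exp ((p + q) / 4) = Real.exp (p / 4) * Real.exp (q / 4) := by
      rw [← Real.exp_add]; congr 1; ring
    have e2 : ∀ p : ℝ, Real.exp (p / (4 * (1 / 2))) = Real.exp (p / 4) ^ 2 := fun p => by
      rw [← Real.exp_nat_mul]; congr 1; push_cast; ring
    rw [e1, e2, e2]
    nlinarith [sq_nonneg (Real.exp (p / 4) - Real.exp (q / 4))]
  have hint : ∀ u : E, ‖u‖ = 1 → Integrable (fun a => Real.exp (‖inner ℂ a u‖ ^ 2 / 4)) μ := by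
    intro u hu
    refine (hexp u hu).mono' ?_ (Filter.Eventually.of_forall fun a => ?_)
    · simp only [hsq]
      exact (((((h u).aemeasurable.pow_const 2).add
        ((h (Complex.I • u)).aemeasurable.pow_const 2)).div_const 4).exp).aestronglyMeasurable
    · rw [Real.norm_eq_abs, Real.abs_exp]
      exact hle a u
  refine ⟨hint, fun u hu => ?_, fun x y => ?_⟩
  · refine (integral_mono (hint u hu) (hexp u hu) fun a => hle a u).trans ?_
    rw [integral_const_mul, integral_add (h.exp_sq (by norm_num) hu).1
      (h.exp_sq (by norm_num) ((hI u).trans hu)).1, (h.exp_sq (by norm_num) hu).2,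
      (h.exp_sq (by norm_num) ((hI u).trans hu)).2]
    linarith [sqrt_two_le_two]
  · have e : ∀ a, ‖inner ℂ a x‖ ^ 2 * ‖inner ℂ a y‖ ^ 2
        = (re (inner ℂ a x) ^ 2 * re (inner ℂ a y) ^ 2
          + re (inner ℂ a x) ^ 2 * re (inner ℂ a (Complex.I • y)) ^ 2)
          + (re (inner ℂ a (Complex.I • x)) ^ 2 * re (inner ℂ a y) ^ 2
          + re (inner ℂ a (Complex.I • x)) ^ 2 * re (inner ℂ a (Complex.I • y)) ^ 2) := fun a => by
      rw [hsq, hsq]; ring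
    simp only [e]
    rw [integral_add, integral_add, integral_add, h.integral_sq_mul_sq, h.integral_sq_mul_sq,
      h.integral_sq_mul_sq, h.integral_sq_mul_sq, hI, hI, hk]
    · simp only [inner_smul_left, inner_smul_right, ← Complex.normSq_eq_norm_sq (inner ℂ x y),
        Complex.normSq_apply]
      simp
      ring
    all_goals first
      | exact h.integrable_sq_mul_sq _ _
      | exact (h.integrable_sq_mul_sq _ _).add (h.integrable_sq_mul_sq _ _)

instance : IsProbabilityMeasure stdReal := by unfold stdReal; infer_instance

instance : IsProbabilityMeasure stdComplex :=
  Measure.isProbabilityMeasure_map (Complex.measurableEquivRealProd.symm.measurable.aemeasurable)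

/-- The product formula at x = y = 1 in dimension one reads E|z|⁴ = 1 + m; the complex case is
identical. -/
theorem moment4_stdReal : moment4 stdReal = 2 := by
  have := (hasGaussianMoments_real isIsotropicGaussian_stdReal).integral_mul 1 1
  have e : ∀ z : ℝ, ‖z‖ ^ 4 = ‖inner ℝ z 1‖ ^ 2 * ‖inner ℝ z 1‖ ^ 2 := fun z => by
    have : inner ℝ z (1 : ℝ) = z := by simp
    rw [this]; ring
  rw [moment4]
  simp only [e, this]
  norm_num

theorem moment4_stdComplex : moment4 stdComplex = 1 := by
  have := (hasGaussianMoments_complex isIsotropicGaussian_stdComplex).integral_mul 1 1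
  have e : ∀ z : ℂ, ‖z‖ ^ 4 = ‖inner ℂ z 1‖ ^ 2 * ‖inner ℂ z 1‖ ^ 2 := fun z => by
    simp; ring
  rw [moment4]
  simp only [e, this]
  norm_num

end Gaussian

/-! ### Nets of the unit sphere. -/

section Nets

open Module Metric
open scoped ENNReal

/-- Balls of radius η/2 about the points are disjoint and lie in the ball of radius 1 + η/2; compare
volumes. -/
theorem card_le_of_separated {E : Type*} [NormedAddCommGroup E] [NormedSpace ℝ E]
    [FiniteDimensional ℝ E] {η : ℝ} (hη : 0 < η) (s : Finset E) (hs : ∀ c ∈ s, ‖c‖ ≤ 1)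
    (h : ∀ c ∈ s, ∀ e ∈ s, c ≠ e → η ≤ ‖c - e‖) :
    (s.card : ℝ) ≤ (2 / η + 1) ^ finrank ℝ E := by
  borelize E
  let μ : Measure E := Measure.addHaar
  have hδ : 0 < η / 2 := by positivity
  have hρ : 0 < 1 + η / 2 := by positivity
  have hdisj : Set.Pairwise (s : Set E) (Function.onFun Disjoint fun c => ball (c : E) (η / 2)) := by
    rintro c hc e he hce
    apply ball_disjoint_ball
    rw [dist_eq_norm]
    linarith [h c hc e he hce]
  have hsub : (⋃ c ∈ s, ball (c : E) (η / 2)) ⊆ ball (0 : E) (1 + η / 2) := by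
    refine Set.iUnion₂_subset fun x hx => ball_subset_ball' ?_
    rw [dist_zero_right]
    linarith [hs x hx]
  have hvol : (s.card : ℝ≥0∞) * ENNReal.ofReal ((η / 2) ^ finrank ℝ E) * μ (ball 0 1) ≤
      ENNReal.ofReal ((1 + η / 2) ^ finrank ℝ E) * μ (ball 0 1) :=
    calc (s.card : ℝ≥0∞) * ENNReal.ofReal ((η / 2) ^ finrank ℝ E) * μ (ball 0 1)
        = μ (⋃ c ∈ s, ball (c : E) (η / 2)) := by
          rw [measure_biUnion_finset hdisj fun c _ => measurableSet_ball]
          simp only [μ.addHaar_ball_of_pos _ hδ]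
          simp only [Finset.sum_const, nsmul_eq_mul, mul_assoc]
      _ ≤ μ (ball (0 : E) (1 + η / 2)) := measure_mono hsub
      _ = _ := by simp only [μ.addHaar_ball_of_pos _ hρ]
  have hvol' : (s.card : ℝ≥0∞) * ENNReal.ofReal ((η / 2) ^ finrank ℝ E)
      ≤ ENNReal.ofReal ((1 + η / 2) ^ finrank ℝ E) :=
    (ENNReal.mul_le_mul_iff_left (measure_ball_pos _ _ zero_lt_one).ne'
      measure_ball_lt_top.ne).1 hvol
  have hreal := ENNReal.toReal_le_of_le_ofReal (pow_nonneg hρ.le _) hvol'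
  rw [ENNReal.toReal_mul, ENNReal.toReal_natCast, ENNReal.toReal_ofReal (by positivity)] at hreal
  have e : (2 / η + 1) * (η / 2) = 1 + η / 2 := by field_simp
  rw [← e, mul_pow] at hreal
  exact le_of_mul_le_mul_right hreal (by positivity)

/-- A separated subset of the sphere of maximal cardinality is a net; the packing bound makes the
maximum exist and also bounds its size. -/
theorem exists_sphere_net (E : Type*) [NormedAddCommGroup E] [NormedSpace ℝ E]
    [FiniteDimensional ℝ E] {η : ℝ} (hη : 0 < η) :
    ∃ N : Finset E, (∀ v ∈ N, ‖v‖ = 1) ∧ (∀ u : E, ‖u‖ = 1 → ∃ v ∈ N, ‖u - v‖ ≤ η) ∧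
      (N.card : ℝ) ≤ (2 / η + 1) ^ finrank ℝ E := by
  classical
  let S : Set ℕ := {k | ∃ s : Finset E, (∀ c ∈ s, ‖c‖ = 1) ∧
    (∀ c ∈ s, ∀ e ∈ s, c ≠ e → η ≤ ‖c - e‖) ∧ s.card = k}
  have hne : S.Nonempty := ⟨0, ∅, by simp, by simp, by simp⟩
  have hb : BddAbove S := by
    refine ⟨⌊(2 / η + 1) ^ finrank ℝ E⌋₊, ?_⟩
    rintro k ⟨s, h1, h2, rfl⟩
    exact Nat.le_floor (card_le_of_separated hη s (fun c hc => (h1 c hc).le) h2)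
  obtain ⟨s, h1, h2, h3⟩ := Nat.sSup_mem hne hb
  refine ⟨s, h1, fun u hu => ?_, card_le_of_separated hη s (fun c hc => (h1 c hc).le) h2⟩
  by_contra! hc
  have hus : u ∉ s := fun hus => by
    have := hc u hus
    simp at this
    linarith
  have : (insert u s).card ∈ S := by
    refine ⟨insert u s, ?_, ?_, rfl⟩
    · intro c hcs
      rcases Finset.mem_insert.1 hcs with rfl | hcs
      · exact hu
      · exact h1 c hcs
    · intro c hcs e hes hce
      rcases Finset.mem_insert.1 hcs with hcu | hcs' <;>
        rcases Finset.mem_insert.1 hes with heu | hes'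
      · exact absurd (hcu.trans heu.symm) hce
      · rw [hcu]; exact (hc e hes').le
      · rw [heu, norm_sub_rev]; exact (hc c hcs').le
      · exact h2 c hcs' e hes' hce
  have hle := le_csSup hb this
  rw [Finset.card_insert_of_notMem hus, ← h3] at hle
  omega

/-- A linear map bounded on an `η`-net of the sphere is bounded on the sphere. -/
theorem norm_le_of_net {𝕜 : Type*} [RCLike 𝕜] {E F : Type*} [NormedAddCommGroup E]
    [NormedSpace 𝕜 E] [FiniteDimensional 𝕜 E] [NormedAddCommGroup F] [NormedSpace 𝕜 F]
    (L : E →ₗ[𝕜] F) {N : Finset E} {η B : ℝ} (hη : η < 1)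
    (hN : ∀ u : E, ‖u‖ = 1 → ∃ v ∈ N, ‖u - v‖ ≤ η) (hB : ∀ v ∈ N, ‖L v‖ ≤ B) (u : E) :
    ‖L u‖ ≤ B / (1 - η) * ‖u‖ := by
  rcases eq_or_ne u 0 with rfl | hu
  · simp
  have : ProperSpace E := FiniteDimensional.proper 𝕜 E
  have hscale : ∀ w : E, w ≠ 0 → ‖((‖w‖⁻¹ : ℝ) : 𝕜) • w‖ = 1 := fun w hw => by
    rw [norm_smul, RCLike.norm_ofReal, abs_of_nonneg (by positivity)]
    exact inv_mul_cancel₀ (norm_ne_zero_iff.2 hw)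
  have hcont : Continuous fun w : E => ‖L w‖ := (LinearMap.continuous_of_finiteDimensional L).norm
  -- At a maximizer the value M = ‖Lw‖ satisfies M ≤ B + Mη, which is then solved for M.
  obtain ⟨w, hw, hmax⟩ := (isCompact_sphere (0 : E) 1).exists_isMaxOn
    ⟨((‖u‖⁻¹ : ℝ) : 𝕜) • u, by simpa using hscale u hu⟩ hcont.continuousOn
  have hw1 : ‖w‖ = 1 := by simpa using hw
  have hbound : ∀ z : E, ‖L z‖ ≤ ‖L w‖ * ‖z‖ := fun z => by
    rcases eq_or_ne z 0 with rfl | hz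
    · simp
    have h1 : ‖L (((‖z‖⁻¹ : ℝ) : 𝕜) • z)‖ ≤ ‖L w‖ :=
      hmax (by simpa using hscale z hz : ((‖z‖⁻¹ : ℝ) : 𝕜) • z ∈ sphere (0 : E) 1)
    rw [map_smul, norm_smul, RCLike.norm_ofReal, abs_of_nonneg (by positivity),
      inv_mul_le_iff₀ (norm_pos_iff.2 hz)] at h1
    linarith
  obtain ⟨v, hv, hvd⟩ := hN w hw1
  have h2 : ‖L w‖ ≤ B + ‖L w‖ * η := by
    calc ‖L w‖ = ‖L v + L (w - v)‖ := by rw [← map_add]; simp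
      _ ≤ ‖L v‖ + ‖L (w - v)‖ := norm_add_le _ _
      _ ≤ B + ‖L w‖ * η := by
        gcongr
        · exact hB v hv
        · exact (hbound _).trans (by gcongr)
  have h3 : ‖L w‖ ≤ B / (1 - η) := by
    rw [le_div_iff₀ (by linarith)]; linarith
  exact (hbound u).trans (by gcongr)

end Nets

/-! ### Exponential moments of truncated quartic terms. -/

section Moments

open RCLike

variable {𝕜 : Type*} [RCLike 𝕜] {E : Type*} [NormedAddCommGroup E]
  [InnerProductSpace 𝕜 E] [MeasurableSpace E] {μ : Measure E} {m : ℝ}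

/-- One term of the exponential series suffices; 98304 = 8⁴ · 4!. -/
theorem pow_four_mul_exp_le {s : ℝ} (hs : 0 ≤ s) :
    s ^ 4 * Real.exp (s / 8) ≤ 98304 * Real.exp (s / 4) := by
  have h := Real.pow_div_factorial_le_exp (s / 8) (by positivity) 4
  have e : Real.exp (s / 4) = Real.exp (s / 8) * Real.exp (s / 8) := by
    rw [← Real.exp_add]; congr 1; ring
  rw [e, ← mul_assoc]
  refine mul_le_mul_of_nonneg_right ?_ (Real.exp_pos _).le
  norm_num [Nat.factorial] at h
  rw [div_pow, div_div, div_le_iff₀ (by norm_num)] at h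
  linarith

theorem pow_three_le_exp {s : ℝ} (hs : 0 ≤ s) : s ^ 3 ≤ 384 * Real.exp (s / 4) := by
  have h := Real.pow_div_factorial_le_exp (s / 4) (by positivity) 3
  norm_num [Nat.factorial] at h
  rw [div_pow, div_div, div_le_iff₀ (by norm_num)] at h
  linarith

theorem le_exp_quarter {s : ℝ} : s ≤ 4 * Real.exp (s / 4) := by
  linarith [Real.add_one_le_exp (s / 4)]

/-- After division by exp t: (1 + s)exp(-s) + s²/2 equals 1 at 0 and has derivative s(1 - exp(-s)) ≥
0. -/
theorem exp_le_quadratic {t : ℝ} (ht : 0 ≤ t) :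
    Real.exp t ≤ 1 + t + t ^ 2 / 2 * Real.exp t := by
  have hderiv : ∀ s : ℝ, HasDerivAt (fun s : ℝ => (1 + s) * Real.exp (-s) + s ^ 2 / 2)
      (s * (1 - Real.exp (-s))) s := fun s => by
    have h1 := (((hasDerivAt_id' s).const_add 1).fun_mul (hasDerivAt_neg' s).exp).fun_add
      ((hasDerivAt_pow 2 s).div_const 2)
    refine h1.congr_deriv ?_
    norm_num
    ring
  have hmono : MonotoneOn (fun s : ℝ => (1 + s) * Real.exp (-s) + s ^ 2 / 2) (Set.Ici 0) := by
    refine monotoneOn_of_deriv_nonneg (convex_Ici 0)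
      (fun s _ => (hderiv s).continuousAt.continuousWithinAt)
      (fun s _ => (hderiv s).differentiableAt.differentiableWithinAt) fun s hs => ?_
    rw [interior_Ici] at hs
    have hs' : 0 < s := hs
    rw [(hderiv s).deriv]
    exact mul_nonneg hs'.le (by simpa using hs'.le)
  have h := hmono (Set.mem_Ici.2 le_rfl) (Set.mem_Ici.2 ht) ht
  simp only [add_zero, neg_zero, Real.exp_zero, mul_one] at h
  have h2 : Real.exp t * 1 ≤ Real.exp t * ((1 + t) * Real.exp (-t) + t ^ 2 / 2) := by
    gcongr
    linarith
  have h3 : Real.exp t * Real.exp (-t) = 1 := by rw [← Real.exp_add]; simp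
  calc Real.exp t = Real.exp t * 1 := by ring
    _ ≤ _ := h2
    _ = (1 + t) * (Real.exp t * Real.exp (-t)) + t ^ 2 / 2 * Real.exp t := by ring
    _ = _ := by rw [h3]; ring

namespace HasGaussianMoments

theorem integrable_of_le (hμ : HasGaussianMoments 𝕜 μ m) {u : E} (hu : ‖u‖ = 1) {f : E → ℝ}
    (hf : Measurable f) {c : ℝ} (h0 : ∀ a, 0 ≤ f a)
    (h : ∀ a, f a ≤ c * Real.exp (‖inner 𝕜 a u‖ ^ 2 / 4)) : Integrable f μ := by
  refine ((hμ.integrable_exp u hu).const_mul c).mono' hf.aestronglyMeasurable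
    (Filter.Eventually.of_forall fun a => ?_)
  rw [Real.norm_eq_abs, abs_of_nonneg (h0 a)]
  exact h a

theorem integral_le_of_le (hμ : HasGaussianMoments 𝕜 μ m) {u : E} (hu : ‖u‖ = 1) {f : E → ℝ}
    (hf : Measurable f) {c : ℝ} (hc : 0 ≤ c) (h0 : ∀ a, 0 ≤ f a)
    (h : ∀ a, f a ≤ c * Real.exp (‖inner 𝕜 a u‖ ^ 2 / 4)) : ∫ a, f a ∂μ ≤ 2 * c := by
  calc ∫ a, f a ∂μ ≤ ∫ a, c * Real.exp (‖inner 𝕜 a u‖ ^ 2 / 4) ∂μ :=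
        integral_mono (hμ.integrable_of_le hu hf h0 h) ((hμ.integrable_exp u hu).const_mul c) h
    _ = c * ∫ a, Real.exp (‖inner 𝕜 a u‖ ^ 2 / 4) ∂μ := integral_const_mul _ _
    _ ≤ c * 2 := by gcongr; exact hμ.integral_exp_le u hu
    _ = 2 * c := by ring

variable [BorelSpace E]

theorem measurable_norm_inner (u : E) : Measurable fun a : E => ‖inner 𝕜 a u‖ :=
  (continuous_id.inner continuous_const).norm.measurable

/-- Bound on the moment generating function of a weighted squared projection. -/
theorem mgf_weighted_le [IsProbabilityMeasure μ] (hμ : HasGaussianMoments 𝕜 μ m) {u : E}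
    (hu : ‖u‖ = 1) {w : E → ℝ} (hw : Measurable w) (hw0 : ∀ a, 0 ≤ w a) {K l b : ℝ} (hK : 0 < K)
    (hwK : ∀ a, w a ≤ K) (hw4 : ∫ a, w a ^ 4 ∂μ ≤ 196608) (hl : 0 ≤ l) (hlK : l * K ≤ 1 / 16)
    (hb : ∫ a, w a * ‖inner 𝕜 a u‖ ^ 2 ∂μ ≤ b) :
    Integrable (fun a => Real.exp (l * (w a * ‖inner 𝕜 a u‖ ^ 2))) μ ∧
    ∫ a, Real.exp (l * (w a * ‖inner 𝕜 a u‖ ^ 2)) ∂μ ≤ Real.exp (l * b + 98304 * l ^ 2) := by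
  have hg := measurable_norm_inner (𝕜 := 𝕜) u
  have hlw : ∀ a, l * w a ≤ 1 / 16 := fun a =>
    (mul_le_mul_of_nonneg_left (hwK a) hl).trans hlK
  have hexp1 : ∀ a, l * (w a * ‖inner 𝕜 a u‖ ^ 2) ≤ ‖inner 𝕜 a u‖ ^ 2 / 16 := fun a => by
    have := mul_le_mul_of_nonneg_right (hlw a) (sq_nonneg ‖inner 𝕜 a u‖)
    linarith
  have hint : Integrable (fun a => Real.exp (l * (w a * ‖inner 𝕜 a u‖ ^ 2))) μ := by
    refine hμ.integrable_of_le (c := 1) hu (by fun_prop) (fun a => (Real.exp_pos _).le) fun a => ?_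
    rw [one_mul, Real.exp_le_exp]
    linarith [hexp1 a, sq_nonneg ‖inner 𝕜 a u‖]
  have hint1 : Integrable (fun a => w a * ‖inner 𝕜 a u‖ ^ 2) μ := by
    refine hμ.integrable_of_le (c := K * 4) hu (by fun_prop)
      (fun a => mul_nonneg (hw0 a) (sq_nonneg _)) fun a => ?_
    rw [mul_assoc]
    exact mul_le_mul (hwK a) le_exp_quarter (sq_nonneg _) hK.le
  have hint4 : Integrable (fun a => w a ^ 4) μ :=
    Integrable.of_bound (C := K ^ 4) (by fun_prop) (Filter.Eventually.of_forall fun a => by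
      rw [Real.norm_eq_abs, abs_of_nonneg (pow_nonneg (hw0 a) 4)]
      exact pow_le_pow_left₀ (hw0 a) (hwK a) 4)
  have h8 : ∀ a : E, (‖inner 𝕜 a u‖ ^ 2) ^ 4 * Real.exp (‖inner 𝕜 a u‖ ^ 2 / 8)
      ≤ 98304 * Real.exp (‖inner 𝕜 a u‖ ^ 2 / 4) := fun a => pow_four_mul_exp_le (sq_nonneg _)
  have hint8 := hμ.integrable_of_le hu (by fun_prop) (fun a => by positivity) h8
  have hle8 := hμ.integral_le_of_le hu (by fun_prop) (by norm_num) (fun a => by positivity) h8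
  -- The quadratic remainder is at most (l²/2) w² · s² exp(s/16), with s = |⟨a,u⟩|², and 2pq ≤ p² +
  -- q² separates w from s. So the variance term sees only the fourth moment of w, while K merely
  -- limits the range of l.
  have hpt : ∀ a, Real.exp (l * (w a * ‖inner 𝕜 a u‖ ^ 2))
      ≤ 1 + l * (w a * ‖inner 𝕜 a u‖ ^ 2) + l ^ 2 / 4 * (w a ^ 4
        + (‖inner 𝕜 a u‖ ^ 2) ^ 4 * Real.exp (‖inner 𝕜 a u‖ ^ 2 / 8)) := fun a => by
    have h1 := exp_le_quadratic (mul_nonneg hl (mul_nonneg (hw0 a) (sq_nonneg ‖inner 𝕜 a u‖)))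
    set s := ‖inner 𝕜 a u‖ ^ 2 with hs
    have hs0 : 0 ≤ s := sq_nonneg _
    have h2 : Real.exp (l * (w a * s)) ≤ Real.exp (s / 16) := Real.exp_le_exp.2 (hexp1 a)
    have h3 : Real.exp (s / 8) = Real.exp (s / 16) ^ 2 := by
      rw [← Real.exp_nat_mul]; congr 1; push_cast; ring
    have h4 : (l * (w a * s)) ^ 2 / 2 * Real.exp (l * (w a * s))
        ≤ (l * (w a * s)) ^ 2 / 2 * Real.exp (s / 16) := by gcongr
    have h5 : 0 ≤ l ^ 2 / 4 * (w a ^ 2 - s ^ 2 * Real.exp (s / 16)) ^ 2 := by positivity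
    rw [h3]
    nlinarith
  refine ⟨hint, ?_⟩
  have hR : Integrable (fun a => 1 + l * (w a * ‖inner 𝕜 a u‖ ^ 2) + l ^ 2 / 4 * (w a ^ 4
        + (‖inner 𝕜 a u‖ ^ 2) ^ 4 * Real.exp (‖inner 𝕜 a u‖ ^ 2 / 8))) μ :=
    ((integrable_const 1).add (hint1.const_mul l)).add ((hint4.add hint8).const_mul _)
  refine (integral_mono hint hR hpt).trans ?_
  rw [integral_add (by exact (integrable_const 1).add (hint1.const_mul l))
    (by exact (hint4.add hint8).const_mul _),
    integral_add (integrable_const 1) (hint1.const_mul l), integral_const_mul, integral_const_mul,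
    integral_add hint4 hint8]
  refine le_trans ?_ (Real.add_one_le_exp _)
  simp only [integral_const, probReal_univ, smul_eq_mul, mul_one]
  have h1 := mul_le_mul_of_nonneg_left hb hl
  have h2 : l ^ 2 / 4 * (∫ a, w a ^ 4 ∂μ
      + ∫ a, (‖inner 𝕜 a u‖ ^ 2) ^ 4 * Real.exp (‖inner 𝕜 a u‖ ^ 2 / 8) ∂μ)
      ≤ l ^ 2 / 4 * (196608 + 2 * 98304) := by gcongr
  linarith

/-- The bound does not depend on K, so the truncation level may grow with n. -/
theorem integral_truncated_sq_pow_le (hμ : HasGaussianMoments 𝕜 μ m) {x : E} (hx : ‖x‖ = 1)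
    {K : ℝ} (hK : 0 ≤ K) : ∫ a, min (‖inner 𝕜 a x‖ ^ 2) K ^ 4 ∂μ ≤ 196608 := by
  have hg := measurable_norm_inner (𝕜 := 𝕜) x
  have := hμ.integral_le_of_le (c := 98304) (f := fun a => min (‖inner 𝕜 a x‖ ^ 2) K ^ 4) hx
    (by fun_prop) (by norm_num)
    (fun a => by positivity) fun a => by
      refine le_trans ?_ (pow_four_mul_exp_le (sq_nonneg ‖inner 𝕜 a x‖))
      calc min (‖inner 𝕜 a x‖ ^ 2) K ^ 4 ≤ (‖inner 𝕜 a x‖ ^ 2) ^ 4 :=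
            pow_le_pow_left₀ (by positivity) (min_le_left _ _) 4
        _ ≤ _ := le_mul_of_one_le_right (by positivity) (Real.one_le_exp (by positivity))
  linarith

theorem integrable_mul (hμ : HasGaussianMoments 𝕜 μ m) {x y : E} (hx : ‖x‖ = 1) (hy : ‖y‖ = 1) :
    Integrable (fun a => ‖inner 𝕜 a x‖ ^ 2 * ‖inner 𝕜 a y‖ ^ 2) μ := by
  have hgx := measurable_norm_inner (𝕜 := 𝕜) x
  have hgy := measurable_norm_inner (𝕜 := 𝕜) y
  have h4 : ∀ s : ℝ, 0 ≤ s → s ^ 2 ≤ 385 * Real.exp (s / 4) := fun s hs => by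
    have h1 := pow_three_le_exp hs
    have h2 : 1 ≤ Real.exp (s / 4) := Real.one_le_exp (by positivity)
    nlinarith [mul_nonneg hs (sq_nonneg (s - 1)), sq_nonneg (s - 1), mul_nonneg hs hs]
  have i1 := hμ.integrable_of_le (f := fun a => (‖inner 𝕜 a x‖ ^ 2) ^ 2) hx (by fun_prop)
    (fun a => by positivity) fun a => h4 _ (sq_nonneg _)
  have i2 := hμ.integrable_of_le (f := fun a => (‖inner 𝕜 a y‖ ^ 2) ^ 2) hy (by fun_prop)
    (fun a => by positivity) fun a => h4 _ (sq_nonneg _)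
  refine (i1.add i2).mono' (by fun_prop) (Filter.Eventually.of_forall fun a => ?_)
  rw [Real.norm_eq_abs, abs_of_nonneg (by positivity), Pi.add_apply]
  nlinarith [sq_nonneg (‖inner 𝕜 a x‖ ^ 2 - ‖inner 𝕜 a y‖ ^ 2), sq_nonneg (‖inner 𝕜 a x‖ ^ 2),
    sq_nonneg (‖inner 𝕜 a y‖ ^ 2)]

theorem integral_truncated_mul_le (hμ : HasGaussianMoments 𝕜 μ m) (hm : 0 ≤ m) {x u : E}
    (hx : ‖x‖ = 1) (hu : ‖u‖ = 1) {K : ℝ} (hK : 0 ≤ K) :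
    ∫ a, min (‖inner 𝕜 a x‖ ^ 2) K * ‖inner 𝕜 a u‖ ^ 2 ∂μ ≤ 1 + m := by
  have hgx := measurable_norm_inner (𝕜 := 𝕜) x
  have hgu := measurable_norm_inner (𝕜 := 𝕜) u
  have hle : ∀ a, min (‖inner 𝕜 a x‖ ^ 2) K * ‖inner 𝕜 a u‖ ^ 2
      ≤ ‖inner 𝕜 a x‖ ^ 2 * ‖inner 𝕜 a u‖ ^ 2 := fun a => by gcongr; exact min_le_left _ _
  have hi := hμ.integrable_mul hx hu
  have hi' : Integrable (fun a => min (‖inner 𝕜 a x‖ ^ 2) K * ‖inner 𝕜 a u‖ ^ 2) μ :=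
    hi.mono' (by fun_prop) (Filter.Eventually.of_forall fun a => by
      rw [Real.norm_eq_abs, abs_of_nonneg (by positivity)]; exact hle a)
  refine (integral_mono hi' hi hle).trans ?_
  rw [hμ.integral_mul, hx, hu]
  have h1 : ‖inner 𝕜 x u‖ ≤ 1 := by simpa [hx, hu] using norm_inner_le_norm (𝕜 := 𝕜) x u
  have h2 : ‖inner 𝕜 x u‖ ^ 2 ≤ 1 := pow_le_one₀ (norm_nonneg _) h1
  nlinarith

theorem integral_sq_le (hμ : HasGaussianMoments 𝕜 μ m) {u : E} (hu : ‖u‖ = 1) :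
    ∫ a, ‖inner 𝕜 a u‖ ^ 2 ∂μ ≤ 8 := by
  have hg := measurable_norm_inner (𝕜 := 𝕜) u
  have := hμ.integral_le_of_le (c := 4) (f := fun a => ‖inner 𝕜 a u‖ ^ 2) hu
    (by fun_prop) (by norm_num) (fun a => by positivity) fun a => le_exp_quarter
  linarith

end HasGaussianMoments

end Moments

/-! ### Radial clipping of scalars. -/

section Clip

open RCLike

variable {𝕜 : Type*} [RCLike 𝕜]

/-- Radial truncation of a scalar at modulus `T`. -/
noncomputable def clip (T : ℝ) (z : 𝕜) : 𝕜 := ((T / max T ‖z‖ : ℝ) : 𝕜) * z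

theorem norm_clip {T : ℝ} (hT : 0 < T) (z : 𝕜) : ‖clip T z‖ = T * ‖z‖ / max T ‖z‖ := by
  have : 0 < max T ‖z‖ := lt_max_of_lt_left hT
  rw [clip, norm_mul, RCLike.norm_ofReal, abs_of_nonneg (by positivity)]
  ring

theorem norm_clip_le {T : ℝ} (hT : 0 < T) (z : 𝕜) : ‖clip T z‖ ≤ T := by
  have : 0 < max T ‖z‖ := lt_max_of_lt_left hT
  rw [norm_clip hT, div_le_iff₀ this]
  gcongr
  exact le_max_right _ _

theorem measurable_clip [MeasurableSpace 𝕜] [BorelSpace 𝕜] (T : ℝ) :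
    Measurable (clip T : 𝕜 → 𝕜) := by
  unfold clip
  fun_prop

/-- Both z and the denominator max(T, |z|) move by at most |z - w|. The constant 2 is not sharp, but
any constant serves. -/
theorem norm_clip_sub_clip_le {T : ℝ} (hT : 0 < T) (z w : 𝕜) :
    ‖clip T z - clip T w‖ ≤ 2 * ‖z - w‖ := by
  set M := max T ‖z‖ with hM
  set M' := max T ‖w‖ with hM'
  have h0 : 0 < M := lt_max_of_lt_left hT
  have h0' : 0 < M' := lt_max_of_lt_left hT
  have hTM : T ≤ M := le_max_left _ _
  have hwM : ‖w‖ ≤ M' := le_max_right _ _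
  have hMM : |M' - M| ≤ ‖z - w‖ := by
    have h1 : |M' - M| ≤ |‖w‖ - ‖z‖| := by
      simpa using abs_max_sub_max_le_max T ‖w‖ T ‖z‖
    exact h1.trans ((abs_norm_sub_norm_le w z).trans (norm_sub_rev w z).le)
  have e : clip T z - clip T w = ((T / M : ℝ) : 𝕜) * (z - w)
      + ((T * (M' - M) / (M * M') : ℝ) : 𝕜) * w := by
    have : T * (M' - M) / (M * M') = T / M - T / M' := by field_simp
    rw [this, clip, clip]
    push_cast
    ring
  rw [e]
  calc _ ≤ ‖((T / M : ℝ) : 𝕜) * (z - w)‖ + ‖((T * (M' - M) / (M * M') : ℝ) : 𝕜) * w‖ :=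
        norm_add_le _ _
    _ = T / M * ‖z - w‖ + (T / M) * (‖w‖ / M') * |M' - M| := by
        rw [norm_mul, norm_mul, RCLike.norm_ofReal, RCLike.norm_ofReal, abs_of_nonneg (a := T / M)
          (by positivity), abs_div, abs_mul, abs_of_pos hT, abs_of_pos (mul_pos h0 h0')]
        field_simp
    _ ≤ 1 * ‖z - w‖ + 1 * 1 * ‖z - w‖ := by
        have h1 : T / M ≤ 1 := (div_le_one h0).2 hTM
        have h2 : ‖w‖ / M' ≤ 1 := (div_le_one h0').2 hwM
        gcongr
    _ = _ := by ring

theorem re_clip_mul_sq {T : ℝ} (z w : 𝕜) :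
    re (clip T z * star (clip T w)) ^ 2
      = (T / max T ‖z‖) ^ 2 * (T / max T ‖w‖) ^ 2 * re (z * star w) ^ 2 := by
  have : clip T z * star (clip T w)
      = ((T / max T ‖z‖ * (T / max T ‖w‖) : ℝ) : 𝕜) * (z * star w) := by
    simp only [clip, star_mul, RCLike.star_def, RCLike.conj_ofReal]
    push_cast
    ring
  rw [this, RCLike.re_ofReal_mul]
  ring

theorem shrink_sq_le_one {T : ℝ} (hT : 0 < T) (r : ℝ) : (T / max T r) ^ 2 ≤ 1 := by
  have : 0 < max T r := lt_max_of_lt_left hT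
  exact pow_le_one₀ (by positivity) ((div_le_one this).2 (le_max_left _ _))

theorem one_sub_shrink_sq_le {T : ℝ} (hT : 0 < T) (r : ℝ) :
    1 - (T / max T r) ^ 2 ≤ r ^ 2 / T ^ 2 := by
  rcases le_total r T with h | h
  · rw [max_eq_left h, div_self hT.ne']
    have : 0 ≤ r ^ 2 / T ^ 2 := by positivity
    linarith
  · have : 1 ≤ r ^ 2 / T ^ 2 := by
      rw [one_le_div (by positivity)]
      exact pow_le_pow_left₀ hT.le h 2
    linarith [sq_nonneg (T / max T r)]

theorem re_mul_star_sq_le (z w : 𝕜) : re (z * star w) ^ 2 ≤ ‖z‖ ^ 2 * ‖w‖ ^ 2 := by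
  have h : |re (z * star w)| ≤ ‖z‖ * ‖w‖ := by
    simpa using RCLike.abs_re_le_norm (z * star w)
  rw [← sq_abs, ← mul_pow]
  exact pow_le_pow_left₀ (abs_nonneg _) h 2

/-- Clipping multiplies by a nonnegative real factor at most 1, so it preserves the phase of z
conj(w): the clipped energy is a true lower bound. -/
theorem re_clip_mul_sq_le {T : ℝ} (hT : 0 < T) (z w : 𝕜) :
    re (clip T z * star (clip T w)) ^ 2 ≤ re (z * star w) ^ 2 := by
  rw [re_clip_mul_sq]
  refine mul_le_of_le_one_left (sq_nonneg _) ?_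
  exact mul_le_one₀ (shrink_sq_le_one hT _) (sq_nonneg _) (shrink_sq_le_one hT _)

/-- Each shrinking factor differs from 1 by at most |z|²/T² or |w|²/T², and ZW(Z + W) ≤ Z³ + W³
turns the loss into sixth moments. -/
theorem re_mul_sq_le_re_clip_mul_sq_add {T : ℝ} (hT : 0 < T) (z w : 𝕜) :
    re (z * star w) ^ 2 ≤ re (clip T z * star (clip T w)) ^ 2
      + ((‖z‖ ^ 2) ^ 3 + (‖w‖ ^ 2) ^ 3) / T ^ 2 := by
  rw [re_clip_mul_sq]
  have h1 := one_sub_shrink_sq_le hT ‖z‖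
  have h2 := one_sub_shrink_sq_le hT ‖w‖
  have h3 := shrink_sq_le_one hT ‖z‖
  have h4 := shrink_sq_le_one hT ‖w‖
  have h5 := re_mul_star_sq_le z w
  set p := (T / max T ‖z‖) ^ 2
  set q := (T / max T ‖w‖) ^ 2
  set s := re (z * star w) ^ 2
  have hs : 0 ≤ s := sq_nonneg _
  have h6 : (1 - p * q) * s ≤ (‖z‖ ^ 2 / T ^ 2 + ‖w‖ ^ 2 / T ^ 2) * (‖z‖ ^ 2 * ‖w‖ ^ 2) := by
    have h7 : 1 - p * q ≤ ‖z‖ ^ 2 / T ^ 2 + ‖w‖ ^ 2 / T ^ 2 := by nlinarith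
    calc (1 - p * q) * s ≤ (‖z‖ ^ 2 / T ^ 2 + ‖w‖ ^ 2 / T ^ 2) * s := by gcongr
      _ ≤ _ := by gcongr
  have h8 : (‖z‖ ^ 2 / T ^ 2 + ‖w‖ ^ 2 / T ^ 2) * (‖z‖ ^ 2 * ‖w‖ ^ 2)
      ≤ ((‖z‖ ^ 2) ^ 3 + (‖w‖ ^ 2) ^ 3) / T ^ 2 := by
    rw [← add_div, div_mul_eq_mul_div]
    gcongr
    have hz := sq_nonneg ‖z‖
    have hw := sq_nonneg ‖w‖
    nlinarith [mul_nonneg (add_nonneg hz hw) (sq_nonneg (‖z‖ ^ 2 - ‖w‖ ^ 2))]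
  linarith

theorem abs_re_clip_mul_sq_sub_le {T : ℝ} (hT : 0 < T) (z w z' w' : 𝕜) :
    |re (clip T z * star (clip T w)) ^ 2 - re (clip T z' * star (clip T w')) ^ 2|
      ≤ 4 * T ^ 3 * (‖z - z'‖ + ‖w - w'‖) := by
  have hb : ∀ x y : 𝕜, |re (clip T x * star (clip T y))| ≤ T ^ 2 := fun x y => by
    calc _ ≤ ‖clip T x * star (clip T y)‖ := RCLike.abs_re_le_norm _
      _ = ‖clip T x‖ * ‖clip T y‖ := by rw [norm_mul, norm_star]
      _ ≤ T * T := by gcongr <;> exact norm_clip_le hT _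
      _ = T ^ 2 := by ring
  have hd : |re (clip T z * star (clip T w)) - re (clip T z' * star (clip T w'))|
      ≤ 2 * T * (‖z - z'‖ + ‖w - w'‖) := by
    have e : clip T z * star (clip T w) - clip T z' * star (clip T w')
        = (clip T z - clip T z') * star (clip T w) + clip T z' * star (clip T w - clip T w') := by
      rw [star_sub]; ring
    rw [← map_sub]
    refine (RCLike.abs_re_le_norm _).trans ?_
    rw [e]
    calc _ ≤ ‖(clip T z - clip T z') * star (clip T w)‖
          + ‖clip T z' * star (clip T w - clip T w')‖ := norm_add_le _ _
      _ = ‖clip T z - clip T z'‖ * ‖clip T w‖ + ‖clip T z'‖ * ‖clip T w - clip T w'‖ := by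
          rw [norm_mul, norm_mul, norm_star, norm_star]
      _ ≤ (2 * ‖z - z'‖) * T + T * (2 * ‖w - w'‖) := by
          gcongr
          · exact norm_clip_sub_clip_le hT _ _
          · exact norm_clip_le hT _
          · exact norm_clip_le hT _
          · exact norm_clip_sub_clip_le hT _ _
      _ = _ := by ring
  rw [sq_sub_sq, abs_mul]
  calc _ ≤ (T ^ 2 + T ^ 2) * (2 * T * (‖z - z'‖ + ‖w - w'‖)) := by
        gcongr
        exact (abs_add_le _ _).trans (add_le_add (hb _ _) (hb _ _))
    _ = _ := by ring

end Clip

/-! ### Chernoff and Hoeffding bounds. -/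

section Chernoff

variable {E Ω : Type*} [MeasurableSpace E] [MeasurableSpace Ω] {μ : Measure E} {P : Measure Ω}
  {n : ℕ} {a : Fin n → Ω → E}

theorem chernoff (hind : iIndepFun a P) (hlaw : ∀ i, HasLaw (a i) μ P)
    {f : E → ℝ} (hf : Measurable f) {l c t : ℝ} (hl : 0 ≤ l)
    (hint : Integrable (fun x => Real.exp (l * f x)) μ)
    (hc : ∫ x, Real.exp (l * f x) ∂μ ≤ Real.exp c) :
    P.real {ω | n * t ≤ ∑ i, f (a i ω)} ≤ Real.exp (n * (c - l * t)) := by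
  have hP : IsProbabilityMeasure P := hind.isProbabilityMeasure
  have hind' : iIndepFun (fun i => f ∘ a i) P := hind.comp (fun _ => f) fun _ => hf
  have hmeas : ∀ i, AEMeasurable (f ∘ a i) P := fun i => hf.comp_aemeasurable (hlaw i).aemeasurable
  have hmgf : ∀ i, mgf (f ∘ a i) P l = ∫ x, Real.exp (l * f x) ∂μ := fun i =>
    (hlaw i).integral_comp (f := fun x => Real.exp (l * f x)) (by fun_prop)
  -- With no samples, `hlaw` says nothing about μ.
  have hμ : IsProbabilityMeasure μ ∨ n = 0 := by
    rcases Nat.eq_zero_or_pos n with h | h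
    · exact Or.inr h
    · exact Or.inl ((hlaw ⟨0, h⟩).isProbabilityMeasure_iff.1 hP)
  have hsum := hind'.mgf_sum₀ (t := l) hmeas Finset.univ
  rw [Finset.prod_congr rfl fun i _ => hmgf i, Finset.prod_const, Finset.card_univ,
    Fintype.card_fin] at hsum
  have hpos : 0 < (∫ x, Real.exp (l * f x) ∂μ) ^ n := by
    rcases hμ with h | h
    · exact pow_pos (integral_exp_pos hint) n
    · simp [h]
  -- If this failed, the integral would be 0 by convention, against the positive product in `hsum`.
  have hintS : Integrable (fun ω => Real.exp (l * (∑ i, f ∘ a i) ω)) P := by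
    by_contra hni
    rw [mgf, integral_undef hni] at hsum
    exact hpos.ne hsum
  have h := measure_ge_le_exp_mul_mgf (n * t) hl hintS
  rw [hsum] at h
  simp only [Finset.sum_apply, Function.comp_apply] at h
  refine h.trans ?_
  calc _ ≤ Real.exp (-l * (n * t)) * Real.exp c ^ n := by
        gcongr
    _ = _ := by
        rw [← Real.exp_nat_mul, ← Real.exp_add]
        congr 1
        ring

/-- Lower tail for sums of bounded nonnegative variables. -/
theorem lower_tail_of_bounded [IsProbabilityMeasure μ] (hind : iIndepFun a P)
    (hlaw : ∀ i, HasLaw (a i) μ P) {g : E → ℝ} (hg : Measurable g) {B : ℝ} (hB : 0 < B)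
    (hg0 : ∀ x, 0 ≤ g x) (hgB : ∀ x, g x ≤ B) {ε : ℝ} (hε : 0 ≤ ε) :
    P.real {ω | n * ε ≤ ∑ i, (∫ x, g x ∂μ - g (a i ω))} ≤ Real.exp (-(n * (2 * ε ^ 2 / B ^ 2))) := by
  have hsub := (hasSubgaussianMGF_of_mem_Icc (X := g) (μ := μ) (a := 0) (b := B) hg.aemeasurable
    (Filter.Eventually.of_forall fun x => ⟨hg0 x, hgB x⟩)).neg
  have hc : (((‖B - 0‖₊ / 2) ^ 2 : NNReal) : ℝ) = (B / 2) ^ 2 := by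
    simp [abs_of_pos hB]
  have e : ∀ x l, l * (∫ y, g y ∂μ - g x) = l * (-fun ω => g ω - ∫ y, g y ∂μ) x := fun x l => by
    simp
  have hm := hsub.mgf_le (4 * ε / B ^ 2)
  rw [hc, mgf] at hm
  have hint := hsub.integrable_exp_mul (4 * ε / B ^ 2)
  -- This l minimizes l²B²/8 - lε, the exponent supplied by Hoeffding's lemma.
  have := chernoff hind hlaw (f := fun x => ∫ y, g y ∂μ - g x) (by fun_prop) (l := 4 * ε / B ^ 2)
    (t := ε) (by positivity) (by simpa only [e] using hint) (by simpa only [e] using hm)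
  refine this.trans (le_of_eq ?_)
  congr 1
  field_simp
  ring

end Chernoff

/-! ### Uniform upper bounds for weighted sums of squared projections. -/

section Uniform

open RCLike

/-- Control of a weighted sum of squared projections by its values on a net. -/
theorem weighted_sum_le_of_net {𝕜 : Type*} [RCLike 𝕜] {E : Type*} [NormedAddCommGroup E]
    [InnerProductSpace 𝕜 E] [FiniteDimensional 𝕜 E] {n : ℕ} {N : Finset E} {η B : ℝ} (hη : η < 1) (hN : ∀ u : E, ‖u‖ = 1 → ∃ v ∈ N, ‖u - v‖ ≤ η) (x : Fin n → E) (w : Fin n → ℝ)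
    (hw : ∀ i, 0 ≤ w i) (hB0 : 0 ≤ B) (hB : ∀ v ∈ N, ∑ i, w i * ‖inner 𝕜 (x i) v‖ ^ 2 ≤ B) (u : E) :
    ∑ i, w i * ‖inner 𝕜 (x i) u‖ ^ 2 ≤ B / (1 - η) ^ 2 * ‖u‖ ^ 2 := by
  -- The weighted sum is ‖Lu‖² for the map u ↦ (√w_i ⟨x_i,u⟩), so the operator net bound applies.
  let L : E →ₗ[𝕜] EuclideanSpace 𝕜 (Fin n) :=
    (WithLp.linearEquiv 2 𝕜 (Fin n → 𝕜)).symm.toLinearMap ∘ₗ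
      LinearMap.pi fun i => ((√(w i) : ℝ) : 𝕜) • (innerSL 𝕜 (x i)).toLinearMap
  have hL : ∀ v, ‖L v‖ ^ 2 = ∑ i, w i * ‖inner 𝕜 (x i) v‖ ^ 2 := fun v => by
    rw [EuclideanSpace.norm_sq_eq]
    refine Finset.sum_congr rfl fun i _ => ?_
    have : L v i = ((√(w i) : ℝ) : 𝕜) * inner 𝕜 (x i) v := rfl
    rw [this, norm_mul, mul_pow, RCLike.norm_ofReal, sq_abs, Real.sq_sqrt (hw i)]
  have h := norm_le_of_net L hη hN (B := √B) (fun v hv => by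
    apply Real.le_sqrt_of_sq_le
    rw [hL]
    exact hB v hv) u
  rw [← hL]
  calc ‖L u‖ ^ 2 ≤ (√B / (1 - η) * ‖u‖) ^ 2 := pow_le_pow_left₀ (norm_nonneg _) h 2
    _ = _ := by rw [mul_pow, div_pow, Real.sq_sqrt hB0]

variable {𝕜 : Type*} [RCLike 𝕜] {E : Type*} [NormedAddCommGroup E]
  [InnerProductSpace 𝕜 E] [MeasurableSpace E] [BorelSpace E] {μ : Measure E} {m : ℝ}
  {Ω : Type*} [MeasurableSpace Ω] {P : Measure Ω} {n : ℕ} {a : Fin n → Ω → E}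

theorem HasGaussianMoments.weighted_sum_tail [IsProbabilityMeasure μ] [FiniteDimensional 𝕜 E]
    (hμ : HasGaussianMoments 𝕜 μ m)
    (hind : iIndepFun a P) (hlaw : ∀ i, HasLaw (a i) μ P) {w : E → ℝ} (hw : Measurable w)
    (hw0 : ∀ x, 0 ≤ w x) {K b ε η : ℝ} (hK : 1 ≤ K) (hwK : ∀ x, w x ≤ K)
    (hw4 : ∫ x, w x ^ 4 ∂μ ≤ 196608) (hε : 0 < ε) (hε1 : ε ≤ 1) (hb0 : 0 ≤ b)
    (hb : ∀ u : E, ‖u‖ = 1 → ∫ x, w x * ‖inner 𝕜 x u‖ ^ 2 ∂μ ≤ b) (hη : η < 1)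
    {N : Finset E} (hN1 : ∀ v ∈ N, ‖v‖ = 1) (hN : ∀ u : E, ‖u‖ = 1 → ∃ v ∈ N, ‖u - v‖ ≤ η) :
    P.real {ω | ¬ ∀ u : E, ∑ i, w (a i ω) * ‖inner 𝕜 (a i ω) u‖ ^ 2
      ≤ n * (b + ε) / (1 - η) ^ 2 * ‖u‖ ^ 2} ≤ N.card * Real.exp (-(n * (ε ^ 2 / (400000 * K)))) := by
  have hP : IsProbabilityMeasure P := hind.isProbabilityMeasure
  have hK0 : 0 < K := by linarith
  have hsub : {ω | ¬ ∀ u : E, ∑ i, w (a i ω) * ‖inner 𝕜 (a i ω) u‖ ^ 2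
      ≤ n * (b + ε) / (1 - η) ^ 2 * ‖u‖ ^ 2}
      ⊆ ⋃ v ∈ N, {ω | n * (b + ε) ≤ ∑ i, w (a i ω) * ‖inner 𝕜 (a i ω) v‖ ^ 2} := by
    intro ω hω
    by_contra hc
    simp only [Set.mem_iUnion, Set.mem_ofPred_eq, not_exists, not_le] at hc
    exact hω fun u => weighted_sum_le_of_net hη hN (fun i => a i ω) (fun i => w (a i ω))
      (fun i => hw0 _) (by positivity) (fun v hv => (hc v hv).le) u
  refine (measureReal_mono hsub (measure_ne_top _ _)).trans
    ((measureReal_biUnion_finset_le _ _).trans ?_)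
  refine le_trans ?_ (nsmul_eq_mul _ _).le
  refine Finset.sum_le_card_nsmul _ _ _ fun v hv => ?_
  have hg := HasGaussianMoments.measurable_norm_inner (𝕜 := 𝕜) v
  -- The optimal l for 98304 l² - lε is ε/196608; dividing by K makes it admissible and costs only
  -- the factor K in the rate.
  have hlK : ε / (196608 * K) * K ≤ 1 / 16 := by
    rw [div_mul_eq_mul_div, mul_div_mul_right _ _ hK0.ne']
    linarith
  obtain ⟨h1, h2⟩ := hμ.mgf_weighted_le (hN1 v hv) hw hw0 hK0 hwK hw4
    (l := ε / (196608 * K)) (by positivity) hlK (hb v (hN1 v hv))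
  refine (chernoff hind hlaw (f := fun x => w x * ‖inner 𝕜 x v‖ ^ 2) (by fun_prop)
    (t := b + ε) (by positivity) h1 h2).trans ?_
  rw [Real.exp_le_exp, ← mul_neg]
  refine mul_le_mul_of_nonneg_left ?_ (Nat.cast_nonneg n)
  have e1 : ε / (196608 * K) * b + 98304 * (ε / (196608 * K)) ^ 2 - ε / (196608 * K) * (b + ε)
      = - (ε ^ 2 / (196608 * K)) * (1 - 1 / (2 * K)) := by
    field_simp
    ring
  rw [e1]
  have h3 : 1 / (2 * K) ≤ 1 / 2 := by
    rw [div_le_div_iff₀ (by positivity) (by norm_num)]; linarith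
  have h4 : 0 ≤ ε ^ 2 / K := by positivity
  have e2 : ε ^ 2 / (196608 * K) = ε ^ 2 / K / 196608 := by field_simp
  have e3 : ε ^ 2 / (400000 * K) = ε ^ 2 / K / 400000 := by field_simp
  rw [e2, e3]
  nlinarith

end Uniform

/-! ### The uniform lower bound through clipped energies. -/

section Lower

open RCLike

variable {𝕜 : Type*} [RCLike 𝕜] {E : Type*} [NormedAddCommGroup E]
  [InnerProductSpace 𝕜 E]

/-- The square of `Re (⟨x, u⟩ conj ⟨x, v⟩)`. -/
noncomputable def crossSq (𝕜 : Type*) [RCLike 𝕜] {E : Type*} [NormedAddCommGroup E]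
    [InnerProductSpace 𝕜 E] (x u v : E) : ℝ :=
  re (inner 𝕜 x u * star (inner 𝕜 x v)) ^ 2

/-- The truncated version of `crossSq`. -/
noncomputable def clipCrossSq (𝕜 : Type*) [RCLike 𝕜] {E : Type*} [NormedAddCommGroup E]
    [InnerProductSpace 𝕜 E] (T : ℝ) (x u v : E) : ℝ :=
  re (clip T (inner 𝕜 x u) * star (clip T (inner 𝕜 x v))) ^ 2

theorem clipCrossSq_nonneg (T : ℝ) (x u v : E) : 0 ≤ clipCrossSq 𝕜 T x u v := sq_nonneg _

theorem clipCrossSq_le {T : ℝ} (hT : 0 < T) (x u v : E) : clipCrossSq 𝕜 T x u v ≤ T ^ 4 := by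
  refine (re_mul_star_sq_le _ _).trans ?_
  have h1 := pow_le_pow_left₀ (norm_nonneg _) (norm_clip_le hT (inner 𝕜 x u)) 2
  have h2 := pow_le_pow_left₀ (norm_nonneg _) (norm_clip_le hT (inner 𝕜 x v)) 2
  calc _ ≤ T ^ 2 * T ^ 2 := by gcongr
    _ = T ^ 4 := by ring

/-- Clipping makes the energy Lipschitz in the two inner products; s ≤ s²/(2η) + η/2 then trades
first powers for the squares that the upper frame bound controls. -/
theorem clipCrossSq_sub_le {T η : ℝ} (hT : 0 < T) (hη : 0 < η) (x u v u' v' : E) :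
    clipCrossSq 𝕜 T x u v - clipCrossSq 𝕜 T x u' v'
      ≤ 4 * T ^ 3 * ((‖inner 𝕜 x (u - u')‖ ^ 2 + ‖inner 𝕜 x (v - v')‖ ^ 2) / (2 * η) + η) := by
  refine (le_abs_self _).trans ((abs_re_clip_mul_sq_sub_le hT _ _ _ _).trans ?_)
  rw [← inner_sub_right, ← inner_sub_right]
  have h : ∀ s : ℝ, s ≤ s ^ 2 / (2 * η) + η / 2 := fun s => by
    have : s ^ 2 / (2 * η) + η / 2 - s = (s - η) ^ 2 / (2 * η) := by field_simp; ring
    have h2 : 0 ≤ (s - η) ^ 2 / (2 * η) := by positivity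
    linarith
  refine mul_le_mul_of_nonneg_left ?_ (by positivity)
  rw [add_div]
  linarith [h ‖inner 𝕜 x (u - u')‖, h ‖inner 𝕜 x (v - v')‖]

theorem exists_unit_smul (w : E) (hw : w ≠ 0) : ∃ e : E, ‖e‖ = 1 ∧ w = (‖w‖ : 𝕜) • e := by
  refine ⟨((‖w‖⁻¹ : ℝ) : 𝕜) • w, ?_, ?_⟩
  · rw [norm_smul, RCLike.norm_ofReal, abs_of_nonneg (by positivity)]
    exact inv_mul_cancel₀ (norm_ne_zero_iff.2 hw)
  · rw [smul_smul, ← RCLike.ofReal_mul, mul_inv_cancel₀ (norm_ne_zero_iff.2 hw)]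
    simp

theorem norm_inner_real_smul_sq (x e : E) (r : ℝ) :
    ‖inner 𝕜 x ((r : 𝕜) • e)‖ ^ 2 = r ^ 2 * ‖inner 𝕜 x e‖ ^ 2 := by
  rw [inner_smul_right, norm_mul, mul_pow, RCLike.norm_ofReal, sq_abs]

theorem crossSq_real_smul (x u v : E) (r s : ℝ) :
    crossSq 𝕜 x ((r : 𝕜) • u) ((s : 𝕜) • v) = r ^ 2 * s ^ 2 * crossSq 𝕜 x u v := by
  have : inner 𝕜 x ((r : 𝕜) • u) * star (inner 𝕜 x ((s : 𝕜) • v))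
      = ((r * s : ℝ) : 𝕜) * (inner 𝕜 x u * star (inner 𝕜 x v)) := by
    simp only [inner_smul_right, star_mul, RCLike.star_def, RCLike.conj_ofReal]
    push_cast
    ring
  rw [crossSq, this, RCLike.re_ofReal_mul, crossSq]
  ring

theorem cross_sum_lower_of_unit [MeasurableSpace E] {μ : Measure E} {n : ℕ} (x : Fin n → E) {ε : ℝ}
    (h : ∀ u v : E, ‖u‖ = 1 → ‖v‖ = 1 →
      n * (∫ y, crossSq 𝕜 y u v ∂μ - ε) ≤ ∑ i, crossSq 𝕜 (x i) u v) (u v : E) :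
    n * (∫ y, crossSq 𝕜 y u v ∂μ - ε * (‖u‖ ^ 2 * ‖v‖ ^ 2)) ≤ ∑ i, crossSq 𝕜 (x i) u v := by
  rcases eq_or_ne u 0 with rfl | hu
  · simp [crossSq]
  rcases eq_or_ne v 0 with rfl | hv
  · simp [crossSq]
  obtain ⟨e, he, hue⟩ := exists_unit_smul (𝕜 := 𝕜) u hu
  obtain ⟨f, hf, hvf⟩ := exists_unit_smul (𝕜 := 𝕜) v hv
  have key : ∀ y, crossSq 𝕜 y u v = ‖u‖ ^ 2 * ‖v‖ ^ 2 * crossSq 𝕜 y e f := fun y => by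
    rw [← crossSq_real_smul, ← hue, ← hvf]
  simp only [key]
  rw [integral_const_mul, ← Finset.mul_sum]
  have := mul_le_mul_of_nonneg_left (h e f he hf) (by positivity : 0 ≤ ‖u‖ ^ 2 * ‖v‖ ^ 2)
  linarith

variable [MeasurableSpace E] [BorelSpace E] {μ : Measure E} {m : ℝ}

theorem measurable_inner_left (u : E) : Measurable fun a : E => inner 𝕜 a u :=
  (continuous_id.inner continuous_const).measurable

theorem measurable_crossSq (u v : E) : Measurable fun x => crossSq 𝕜 x u v := by
  have h1 := measurable_inner_left (𝕜 := 𝕜) u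
  have h2 := measurable_inner_left (𝕜 := 𝕜) v
  exact (RCLike.measurable_re.comp (h1.mul (RCLike.continuous_conj.measurable.comp h2))).pow_const 2

theorem measurable_clipCrossSq (T : ℝ) (u v : E) :
    Measurable fun x => clipCrossSq 𝕜 T x u v := by
  have h1 := (measurable_clip T).comp (measurable_inner_left (𝕜 := 𝕜) u)
  have h2 := (measurable_clip T).comp (measurable_inner_left (𝕜 := 𝕜) v)
  exact (RCLike.measurable_re.comp (h1.mul (RCLike.continuous_conj.measurable.comp h2))).pow_const 2

theorem integrable_clipCrossSq [IsFiniteMeasure μ] {T : ℝ} (hT : 0 < T) (u v : E) :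
    Integrable (fun x => clipCrossSq 𝕜 T x u v) μ :=
  Integrable.of_bound (C := T ^ 4) (measurable_clipCrossSq T u v).aestronglyMeasurable
    (Filter.Eventually.of_forall fun x => by
      rw [Real.norm_eq_abs, abs_of_nonneg (clipCrossSq_nonneg T x u v)]
      exact clipCrossSq_le hT x u v)

namespace HasGaussianMoments

theorem integrable_sq (hμ : HasGaussianMoments 𝕜 μ m) (w : E) :
    Integrable (fun a => ‖inner 𝕜 a w‖ ^ 2) μ := by
  rcases eq_or_ne w 0 with rfl | hw
  · simp
  obtain ⟨e, he, hwe⟩ := exists_unit_smul (𝕜 := 𝕜) w hw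
  rw [hwe]
  simp only [norm_inner_real_smul_sq]
  have hg := measurable_norm_inner (𝕜 := 𝕜) e
  exact (hμ.integrable_of_le (c := 4) he (f := fun a => ‖inner 𝕜 a e‖ ^ 2) (by fun_prop)
    (fun a => by positivity) fun a => le_exp_quarter).const_mul _

theorem integral_sq_le_norm (hμ : HasGaussianMoments 𝕜 μ m) (w : E) :
    ∫ a, ‖inner 𝕜 a w‖ ^ 2 ∂μ ≤ 8 * ‖w‖ ^ 2 := by
  rcases eq_or_ne w 0 with rfl | hw
  · simp
  obtain ⟨e, he, hwe⟩ := exists_unit_smul (𝕜 := 𝕜) w hw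
  conv_lhs => rw [hwe]
  simp only [norm_inner_real_smul_sq]
  rw [integral_const_mul, mul_comm]
  gcongr
  exact hμ.integral_sq_le he

theorem integrable_mul_sq (hμ : HasGaussianMoments 𝕜 μ m) (x y : E) :
    Integrable (fun a => ‖inner 𝕜 a x‖ ^ 2 * ‖inner 𝕜 a y‖ ^ 2) μ := by
  rcases eq_or_ne x 0 with rfl | hx
  · simp
  rcases eq_or_ne y 0 with rfl | hy
  · simp
  obtain ⟨e, he, hxe⟩ := exists_unit_smul (𝕜 := 𝕜) x hx
  obtain ⟨f, hf, hyf⟩ := exists_unit_smul (𝕜 := 𝕜) y hy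
  rw [hxe, hyf]
  simp only [norm_inner_real_smul_sq]
  refine ((hμ.integrable_mul he hf).const_mul (‖x‖ ^ 2 * ‖y‖ ^ 2)).congr
    (Filter.Eventually.of_forall fun a => ?_)
  simp only
  ring

theorem integrable_crossSq (hμ : HasGaussianMoments 𝕜 μ m) (u v : E) :
    Integrable (fun x => crossSq 𝕜 x u v) μ :=
  (hμ.integrable_mul_sq u v).mono' (measurable_crossSq u v).aestronglyMeasurable
    (Filter.Eventually.of_forall fun x => by
      rw [Real.norm_eq_abs, abs_of_nonneg (sq_nonneg _)]
      exact re_mul_star_sq_le _ _)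

theorem integral_crossSq_le [IsProbabilityMeasure μ] (hμ : HasGaussianMoments 𝕜 μ m) {T : ℝ}
    (hT : 0 < T) {u v : E} (hu : ‖u‖ = 1) (hv : ‖v‖ = 1) :
    ∫ x, crossSq 𝕜 x u v ∂μ ≤ ∫ x, clipCrossSq 𝕜 T x u v ∂μ + 1536 / T ^ 2 := by
  have hgu := measurable_norm_inner (𝕜 := 𝕜) u
  have hgv := measurable_norm_inner (𝕜 := 𝕜) v
  have hiu := hμ.integrable_of_le (f := fun a => (‖inner 𝕜 a u‖ ^ 2) ^ 3) hu (by fun_prop)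
    (fun a => by positivity) fun a => pow_three_le_exp (sq_nonneg _)
  have hiv := hμ.integrable_of_le (f := fun a => (‖inner 𝕜 a v‖ ^ 2) ^ 3) hv (by fun_prop)
    (fun a => by positivity) fun a => pow_three_le_exp (sq_nonneg _)
  have hlu := hμ.integral_le_of_le (f := fun a => (‖inner 𝕜 a u‖ ^ 2) ^ 3) hu (by fun_prop)
    (by norm_num) (fun a => by positivity) fun a => pow_three_le_exp (sq_nonneg _)
  have hlv := hμ.integral_le_of_le (f := fun a => (‖inner 𝕜 a v‖ ^ 2) ^ 3) hv (by fun_prop)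
    (by norm_num) (fun a => by positivity) fun a => pow_three_le_exp (sq_nonneg _)
  have hic := integrable_clipCrossSq (𝕜 := 𝕜) (μ := μ) hT u v
  calc ∫ x, crossSq 𝕜 x u v ∂μ
      ≤ ∫ x, (clipCrossSq 𝕜 T x u v
          + ((‖inner 𝕜 x u‖ ^ 2) ^ 3 + (‖inner 𝕜 x v‖ ^ 2) ^ 3) / T ^ 2) ∂μ :=
        integral_mono (hμ.integrable_crossSq u v) (hic.add ((hiu.add hiv).div_const _)) fun x =>
          re_mul_sq_le_re_clip_mul_sq_add hT _ _
    _ = ∫ x, clipCrossSq 𝕜 T x u v ∂μ + (∫ x, (‖inner 𝕜 x u‖ ^ 2) ^ 3 ∂μ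
          + ∫ x, (‖inner 𝕜 x v‖ ^ 2) ^ 3 ∂μ) / T ^ 2 := by
        rw [integral_add hic (by exact (hiu.add hiv).div_const _), integral_div, integral_add hiu hiv]
    _ ≤ _ := by
        gcongr
        linarith

/-- Passage from a net to the sphere in the lower bound for the truncated energies. -/
theorem cross_sum_lower_of_net [IsProbabilityMeasure μ] (hμ : HasGaussianMoments 𝕜 μ m) {n : ℕ}
    (x : Fin n → E) {N : Finset E} {T η ε : ℝ} (hT : 0 < T) (hη : 0 < η)
    (hN : ∀ u : E, ‖u‖ = 1 → ∃ v ∈ N, ‖u - v‖ ≤ η)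
    (hup : ∀ w : E, ∑ i, ‖inner 𝕜 (x i) w‖ ^ 2 ≤ n * 36 * ‖w‖ ^ 2)
    (hnet : ∀ u ∈ N, ∀ v ∈ N,
      ∑ i, (∫ y, clipCrossSq 𝕜 T y u v ∂μ - clipCrossSq 𝕜 T (x i) u v) ≤ n * ε)
    {u v : E} (hu : ‖u‖ = 1) (hv : ‖v‖ = 1) :
    n * (∫ y, crossSq 𝕜 y u v ∂μ - (ε + 184 * T ^ 3 * η + 1536 / T ^ 2))
      ≤ ∑ i, crossSq 𝕜 (x i) u v := by
  obtain ⟨u', hu', huu⟩ := hN u hu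
  obtain ⟨v', hv', hvv⟩ := hN v hv
  have hn : (0 : ℝ) ≤ n := Nat.cast_nonneg n
  have huu2 : ‖u' - u‖ ^ 2 ≤ η ^ 2 := by
    rw [norm_sub_rev]; exact pow_le_pow_left₀ (norm_nonneg _) huu 2
  have hvv2 : ‖v' - v‖ ^ 2 ≤ η ^ 2 := by
    rw [norm_sub_rev]; exact pow_le_pow_left₀ (norm_nonneg _) hvv 2
  -- Moving to the net costs 4T³(36 + 1)η per sample here and 4T³(8 + 1)η in the expectation below,
  -- in total 184T³η.
  have hA : ∑ i, clipCrossSq 𝕜 T (x i) u' v' - ∑ i, clipCrossSq 𝕜 T (x i) u v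
      ≤ n * (148 * T ^ 3 * η) := by
    rw [← Finset.sum_sub_distrib]
    calc _ ≤ ∑ i, 4 * T ^ 3 * ((‖inner 𝕜 (x i) (u' - u)‖ ^ 2 + ‖inner 𝕜 (x i) (v' - v)‖ ^ 2)
          / (2 * η) + η) := Finset.sum_le_sum fun i _ => clipCrossSq_sub_le hT hη _ _ _ _ _
      _ = 4 * T ^ 3 * ((∑ i, ‖inner 𝕜 (x i) (u' - u)‖ ^ 2 + ∑ i, ‖inner 𝕜 (x i) (v' - v)‖ ^ 2)
          / (2 * η) + n * η) := by
        rw [← Finset.mul_sum, Finset.sum_add_distrib, ← Finset.sum_div, Finset.sum_add_distrib]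
        simp
      _ ≤ 4 * T ^ 3 * ((n * 36 * η ^ 2 + n * 36 * η ^ 2) / (2 * η) + n * η) := by
        have h1 := (hup (u' - u)).trans (mul_le_mul_of_nonneg_left huu2 (by positivity))
        have h2 := (hup (v' - v)).trans (mul_le_mul_of_nonneg_left hvv2 (by positivity))
        gcongr
      _ = _ := by field_simp; ring
  have hB : ∫ y, clipCrossSq 𝕜 T y u v ∂μ - ∫ y, clipCrossSq 𝕜 T y u' v' ∂μ
      ≤ 36 * T ^ 3 * η := by
    have i1 := hμ.integrable_sq (u - u')
    have i2 := hμ.integrable_sq (v - v')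
    rw [← integral_sub (integrable_clipCrossSq hT u v) (integrable_clipCrossSq hT u' v')]
    calc _ ≤ ∫ y, 4 * T ^ 3 * ((‖inner 𝕜 y (u - u')‖ ^ 2 + ‖inner 𝕜 y (v - v')‖ ^ 2)
          / (2 * η) + η) ∂μ :=
          integral_mono ((integrable_clipCrossSq hT u v).sub (integrable_clipCrossSq hT u' v'))
            ((((i1.add i2).div_const _).add (integrable_const _)).const_mul _)
            fun y => clipCrossSq_sub_le hT hη _ _ _ _ _
      _ = 4 * T ^ 3 * ((∫ y, ‖inner 𝕜 y (u - u')‖ ^ 2 ∂μ + ∫ y, ‖inner 𝕜 y (v - v')‖ ^ 2 ∂μ)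
          / (2 * η) + η) := by
        rw [integral_const_mul, integral_add (by exact (i1.add i2).div_const _) (integrable_const _),
          integral_div, integral_add i1 i2]
        simp
      _ ≤ 4 * T ^ 3 * ((8 * η ^ 2 + 8 * η ^ 2) / (2 * η) + η) := by
        rw [norm_sub_rev] at huu2 hvv2
        have h1 := (hμ.integral_sq_le_norm (u - u')).trans
          (mul_le_mul_of_nonneg_left huu2 (by norm_num))
        have h2 := (hμ.integral_sq_le_norm (v - v')).trans
          (mul_le_mul_of_nonneg_left hvv2 (by norm_num))
        gcongr
      _ = _ := by field_simp; ring
  have hC := hμ.integral_crossSq_le hT hu hv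
  have hD := hnet u' hu' v' hv'
  rw [Finset.sum_sub_distrib] at hD
  simp only [Finset.sum_const, Finset.card_univ, Fintype.card_fin, nsmul_eq_mul] at hD
  have hF : ∑ i, clipCrossSq 𝕜 T (x i) u v ≤ ∑ i, crossSq 𝕜 (x i) u v :=
    Finset.sum_le_sum fun i _ => re_clip_mul_sq_le hT _ _
  have hG := mul_le_mul_of_nonneg_left hB hn
  have hH := mul_le_mul_of_nonneg_left hC hn
  linarith

/-- The expected squared difference of two intensities. -/
theorem integral_sub_sq (hμ : HasGaussianMoments 𝕜 μ m) [IsProbabilityMeasure μ] (x y : E) :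
    ∫ a, (‖inner 𝕜 a x‖ ^ 2 - ‖inner 𝕜 a y‖ ^ 2) ^ 2 ∂μ
      = m * ((‖x‖ ^ 2) ^ 2 + (‖y‖ ^ 2) ^ 2 - 2 * ‖inner 𝕜 x y‖ ^ 2)
        + (‖x‖ ^ 2 - ‖y‖ ^ 2) ^ 2 := by
  have e : ∀ a : E, (‖inner 𝕜 a x‖ ^ 2 - ‖inner 𝕜 a y‖ ^ 2) ^ 2
      = (‖inner 𝕜 a x‖ ^ 2 * ‖inner 𝕜 a x‖ ^ 2 + ‖inner 𝕜 a y‖ ^ 2 * ‖inner 𝕜 a y‖ ^ 2)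
        - 2 * (‖inner 𝕜 a x‖ ^ 2 * ‖inner 𝕜 a y‖ ^ 2) := fun a => by ring
  simp only [e]
  rw [integral_sub (by exact (hμ.integrable_mul_sq x x).add (hμ.integrable_mul_sq y y))
    ((hμ.integrable_mul_sq x y).const_mul 2), integral_add (hμ.integrable_mul_sq x x)
    (hμ.integrable_mul_sq y y), integral_const_mul, hμ.integral_mul, hμ.integral_mul,
    hμ.integral_mul]
  have h : ∀ z : E, ‖inner 𝕜 z z‖ ^ 2 = (‖z‖ ^ 2) ^ 2 := fun z => by
    rw [inner_self_eq_norm_sq_to_K]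
    simp
  rw [h, h]
  ring

/-- Lower restricted isometry for differences of rank one matrices, from the uniform lower bound
for products of projections. -/
theorem lower_isometry (hμ : HasGaussianMoments 𝕜 μ m) [IsProbabilityMeasure μ] {n : ℕ}
    (a : Fin n → E) {ε : ℝ} (hm : 0 < m) (hε : 0 ≤ ε)
    (h : ∀ u v : E, n * (∫ y, crossSq 𝕜 y u v ∂μ - ε * (‖u‖ ^ 2 * ‖v‖ ^ 2))
      ≤ ∑ i, crossSq 𝕜 (a i) u v) (x y : E) :
    n * ((1 - 2 * ε / m) * (m * ((‖x‖ ^ 2) ^ 2 + (‖y‖ ^ 2) ^ 2 - 2 * ‖inner 𝕜 x y‖ ^ 2)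
        + (‖x‖ ^ 2 - ‖y‖ ^ 2) ^ 2))
      ≤ ∑ i, (‖inner 𝕜 (a i) x‖ ^ 2 - ‖inner 𝕜 (a i) y‖ ^ 2) ^ 2 := by
  -- align the phases
  obtain ⟨s, hs, hsxy⟩ : ∃ s : 𝕜, ‖s‖ = 1 ∧ re (inner 𝕜 x (s • y)) = ‖inner 𝕜 x y‖ := by
    rcases eq_or_ne (inner 𝕜 x y) 0 with h0 | h0
    · exact ⟨1, by simp, by simp [h0]⟩
    · have hn : ‖inner 𝕜 x y‖ ≠ 0 := norm_ne_zero_iff.2 h0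
      refine ⟨star (inner 𝕜 x y) / (‖inner 𝕜 x y‖ : 𝕜), ?_, ?_⟩
      · rw [norm_div, norm_star, RCLike.norm_ofReal, abs_of_nonneg (norm_nonneg _), div_self hn]
      · rw [inner_smul_right, div_mul_eq_mul_div, RCLike.star_def, RCLike.conj_mul,
          ← RCLike.ofReal_pow, ← RCLike.ofReal_div, RCLike.ofReal_re]
        field_simp
  have hsy : ‖s • y‖ = ‖y‖ := by rw [norm_smul, hs, one_mul]
  -- This holds for every unimodular s, because the mixed terms are purely imaginary. The alignment
  -- of s matters only for `h2` below.
  have hcross : ∀ b : E, crossSq 𝕜 b (x + s • y) (x - s • y)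
      = (‖inner 𝕜 b x‖ ^ 2 - ‖inner 𝕜 b y‖ ^ 2) ^ 2 := fun b => by
    have e1 : ‖inner 𝕜 b y‖ = ‖inner 𝕜 b (s • y)‖ := by
      rw [inner_smul_right, norm_mul, hs, one_mul]
    rw [crossSq, e1, inner_add_right, inner_sub_right]
    set p := inner 𝕜 b x
    set q := inner 𝕜 b (s • y)
    congr 1
    have e2 : (p + q) * star (p - q) = (p * star p - q * star q) + (q * star p - p * star q) := by
      rw [star_sub]; ring
    have e3 : re (q * star p) = re (p * star q) := by
      rw [← RCLike.conj_re, ← RCLike.star_def, star_mul, star_star]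
    rw [e2, map_add, map_sub, map_sub, e3, sub_self, add_zero]
    simp only [RCLike.star_def, RCLike.mul_conj, ← RCLike.ofReal_pow, RCLike.ofReal_re]
  have h1 := h (x + s • y) (x - s • y)
  simp only [hcross] at h1
  rw [hμ.integral_sub_sq] at h1
  refine le_trans (mul_le_mul_of_nonneg_left ?_ (Nat.cast_nonneg n)) h1
  have e1 := norm_add_sq (𝕜 := 𝕜) x (s • y)
  have e2 := norm_sub_sq (𝕜 := 𝕜) x (s • y)
  rw [hsxy, hsy] at e1 e2
  rw [e1, e2]
  have hg : 0 ≤ ‖inner 𝕜 x y‖ := norm_nonneg _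
  set g := ‖inner 𝕜 x y‖
  set X := ‖x‖ ^ 2
  set Y := ‖y‖ ^ 2
  -- By alignment the left side is ‖x + sy‖² ‖x - sy‖², and the right side is twice the squared
  -- Frobenius distance. So the error ε becomes a relative error 2ε/m.
  have h2 : (X + 2 * g + Y) * (X - 2 * g + Y) ≤ 2 * (X ^ 2 + Y ^ 2 - 2 * g ^ 2) := by
    nlinarith [sq_nonneg (X - Y)]
  have h3 : ε * ((X + 2 * g + Y) * (X - 2 * g + Y)) ≤ ε * (2 * (X ^ 2 + Y ^ 2 - 2 * g ^ 2)) := by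
    gcongr
  have h4 : 2 * ε / m * (m * (X ^ 2 + Y ^ 2 - 2 * g ^ 2) + (X - Y) ^ 2)
      = ε * (2 * (X ^ 2 + Y ^ 2 - 2 * g ^ 2)) + 2 * ε / m * (X - Y) ^ 2 := by
    field_simp
  have h5 : 0 ≤ 2 * ε / m * (X - Y) ^ 2 := by positivity
  linarith

end HasGaussianMoments

end Lower

/-! ### The sample size d log d. -/

section SampleSize

/-- The factor log n must be absorbed although the hypothesis offers log d. If d² ≤ n, then d ≤ √n
and log n is negligible against √n; otherwise log n ≤ 2 log d. -/
theorem exists_sample_size {κ c : ℝ} (hκ : 0 < κ) (hc : 0 < c) :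
    ∃ (c₁ : ℝ) (n₀ : ℕ), 0 < c₁ ∧ ∀ d n : ℕ, n₀ ≤ n → c₁ * d * Real.log d ≤ n →
      κ * d - c * n / (1 + 12 * Real.log n) ≤ -2 * Real.log n := by
  have h1 : ∀ᶠ x : ℝ in Filter.atTop, ‖Real.log x ^ 2‖ ≤ c / 52 * ‖id x‖ :=
    Real.isLittleO_pow_log_id_atTop.def (by positivity)
  have h2 : ∀ᶠ x : ℝ in Filter.atTop, ‖Real.log x‖ ≤ c / (26 * κ) * ‖x ^ (1 / 2 : ℝ)‖ :=
    (isLittleO_log_rpow_atTop (by norm_num)).def (by positivity)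
  obtain ⟨n₀, hn₀⟩ := Filter.eventually_atTop.1
    (tendsto_natCast_atTop_atTop.eventually (h1.and h2))
  refine ⟨52 * κ / c, max n₀ 3, by positivity, fun d n hn hdn => ?_⟩
  obtain ⟨h3, h4⟩ := hn₀ n ((le_max_left _ _).trans hn)
  have hn3 : (3 : ℝ) ≤ n := by exact_mod_cast (le_max_right _ _).trans hn
  have hL : 1 ≤ Real.log n := by
    rw [Real.le_log_iff_exp_le (by linarith)]
    linarith [Real.exp_one_lt_d9]
  rw [← Real.sqrt_eq_rpow] at h4
  set L := Real.log n with hLdef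
  have hL0 : 0 ≤ L := by linarith
  have hn0 : (0 : ℝ) ≤ n := Nat.cast_nonneg n
  rw [Real.norm_eq_abs, abs_of_nonneg (by positivity), id, Real.norm_eq_abs,
    abs_of_nonneg hn0] at h3
  rw [Real.norm_eq_abs, abs_of_nonneg hL0, Real.norm_eq_abs, abs_of_nonneg (Real.sqrt_nonneg _)] at h4
  have h5 : 13 * κ * d * L ≤ c * n / 2 := by
    rcases le_total ((d : ℝ) ^ 2) n with h | h
    · have hd : (d : ℝ) ≤ √n := Real.le_sqrt_of_sq_le h
      calc 13 * κ * d * L ≤ 13 * κ * √n * (c / (26 * κ) * √n) := by gcongr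
        _ = c / 2 * (√n * √n) := by field_simp; ring
        _ = c * n / 2 := by rw [Real.mul_self_sqrt hn0]; ring
    · have hLd : L ≤ 2 * Real.log d := by
        have := Real.log_le_log (by linarith) h
        rwa [Real.log_pow] at this
      have h6 : 52 * κ / c * d * Real.log d * c ≤ n * c := by gcongr
      have h7 : 52 * κ / c * d * Real.log d * c = 52 * κ * d * Real.log d := by field_simp
      have h8 : 13 * κ * d * L ≤ 13 * κ * d * (2 * Real.log d) := by gcongr
      linarith
  have h9 : κ * d + 2 * L ≤ c * n / (1 + 12 * L) := by
    rw [le_div_iff₀ (by positivity)]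
    have h10 : 0 ≤ κ * d + 2 * L := by positivity
    calc (κ * d + 2 * L) * (1 + 12 * L) ≤ (κ * d + 2 * L) * (13 * L) := by gcongr; linarith
      _ = 13 * κ * d * L + 26 * L ^ 2 := by ring
      _ ≤ c * n / 2 + 26 * (c / 52 * n) := by gcongr
      _ = c * n := by ring
  linarith

end SampleSize

/-! ### Probability of a good sample. -/

section GoodSample

open RCLike Module

/-- The deterministic event on which the measurement conditions hold: an upper bound on the
weighted frame operator, and a lower isometry for differences of rank one matrices. -/
def IsGoodSample (𝕜 : Type*) [RCLike 𝕜] {E : Type*} [NormedAddCommGroup E] [InnerProductSpace 𝕜 E]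
    {n : ℕ} (a : Fin n → E) (xs : E) (m δL δU : ℝ) : Prop :=
  (∀ u : E, ∑ i, ‖inner 𝕜 (a i) xs‖ ^ 2 * ‖inner 𝕜 (a i) u‖ ^ 2
    ≤ n * ((1 + m + δU) * ‖xs‖ ^ 2) * ‖u‖ ^ 2) ∧
  ∀ x : E, n * ((1 - δL) * (m * ((‖x‖ ^ 2) ^ 2 + (‖xs‖ ^ 2) ^ 2 - 2 * ‖inner 𝕜 x xs‖ ^ 2)
      + (‖x‖ ^ 2 - ‖xs‖ ^ 2) ^ 2))
    ≤ ∑ i, (‖inner 𝕜 (a i) x‖ ^ 2 - ‖inner 𝕜 (a i) xs‖ ^ 2) ^ 2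

theorem finrank_euclideanSpace_le (𝕜 : Type*) [RCLike 𝕜] (d : ℕ) :
    finrank ℝ (EuclideanSpace 𝕜 (Fin d)) ≤ 2 * d := by
  rw [← finrank_mul_finrank ℝ 𝕜]
  simpa using Nat.mul_le_mul_right d (RCLike.finrank_le_two (K := 𝕜))

section Tails

variable {𝕜 : Type*} [RCLike 𝕜] {E : Type*} [NormedAddCommGroup E]
  [InnerProductSpace 𝕜 E] [MeasurableSpace E] [BorelSpace E] {μ : Measure E} {m : ℝ}
  {Ω : Type*} [MeasurableSpace Ω] {P : Measure Ω} {n : ℕ} {a : Fin n → Ω → E}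

theorem HasGaussianMoments.max_tail [IsProbabilityMeasure μ] (hμ : HasGaussianMoments 𝕜 μ m)
    [IsProbabilityMeasure P] (hlaw : ∀ i, HasLaw (a i) μ P) {e : E} (he : ‖e‖ = 1) (K : ℝ) :
    P.real {ω | ¬ ∀ i, ‖inner 𝕜 (a i ω) e‖ ^ 2 ≤ K} ≤ n * (2 * Real.exp (-(K / 4))) := by
  have hg := HasGaussianMoments.measurable_norm_inner (𝕜 := 𝕜) e
  have hsub : {ω | ¬ ∀ i, ‖inner 𝕜 (a i ω) e‖ ^ 2 ≤ K}
      ⊆ ⋃ i ∈ (Finset.univ : Finset (Fin n)), {ω | K ≤ ‖inner 𝕜 (a i ω) e‖ ^ 2} := by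
    intro ω hω
    simp only [Set.mem_ofPred_eq, not_forall, not_le] at hω
    obtain ⟨i, hi⟩ := hω
    simp only [Set.mem_iUnion]
    exact ⟨i, Finset.mem_univ _, hi.le⟩
  refine (measureReal_mono hsub (measure_ne_top _ _)).trans
    ((measureReal_biUnion_finset_le _ _).trans ?_)
  have hone : ∀ i, P.real {ω | K ≤ ‖inner 𝕜 (a i ω) e‖ ^ 2} ≤ 2 * Real.exp (-(K / 4)) := by
    intro i
    rw [(hlaw i).measureReal_eq (p := fun x => K ≤ ‖inner 𝕜 x e‖ ^ 2)
      (measurableSet_le measurable_const (hg.pow_const 2))]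
    have h1 := mul_meas_ge_le_integral_of_nonneg (μ := μ)
      (f := fun x => Real.exp (‖inner 𝕜 x e‖ ^ 2 / 4))
      (Filter.Eventually.of_forall fun x => (Real.exp_pos _).le) (hμ.integrable_exp e he)
      (Real.exp (K / 4))
    have h2 : {x : E | Real.exp (K / 4) ≤ Real.exp (‖inner 𝕜 x e‖ ^ 2 / 4)}
        = {x | K ≤ ‖inner 𝕜 x e‖ ^ 2} := by
      ext x
      simp only [Set.mem_ofPred_eq, Real.exp_le_exp]
      constructor <;> intro h <;> linarith
    rw [h2] at h1
    have h3 := h1.trans (hμ.integral_exp_le e he)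
    rw [Real.exp_neg, ← div_eq_mul_inv, le_div_iff₀ (Real.exp_pos _)]
    linarith
  refine (Finset.sum_le_sum fun i _ => hone i).trans ?_
  simp

theorem clip_tail [IsProbabilityMeasure μ]
    [IsProbabilityMeasure P] (hind : iIndepFun a P) (hlaw : ∀ i, HasLaw (a i) μ P)
    (N : Finset E) {T ε : ℝ} (hT : 0 < T) (hε : 0 ≤ ε) :
    P.real {ω | ¬ ∀ u ∈ N, ∀ v ∈ N,
      ∑ i, (∫ y, clipCrossSq 𝕜 T y u v ∂μ - clipCrossSq 𝕜 T (a i ω) u v) ≤ n * ε}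
      ≤ N.card * (N.card * Real.exp (-(n * (2 * ε ^ 2 / (T ^ 4) ^ 2)))) := by
  have hsub : {ω | ¬ ∀ u ∈ N, ∀ v ∈ N,
      ∑ i, (∫ y, clipCrossSq 𝕜 T y u v ∂μ - clipCrossSq 𝕜 T (a i ω) u v) ≤ n * ε}
      ⊆ ⋃ u ∈ N, ⋃ v ∈ N, {ω | n * ε ≤
        ∑ i, (∫ y, clipCrossSq 𝕜 T y u v ∂μ - clipCrossSq 𝕜 T (a i ω) u v)} := by
    intro ω hω
    by_contra hc
    simp only [Set.mem_iUnion, Set.mem_ofPred_eq, not_exists, not_le] at hc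
    exact hω fun u hu v hv => (hc u hu v hv).le
  refine (measureReal_mono hsub (measure_ne_top _ _)).trans
    ((measureReal_biUnion_finset_le _ _).trans ?_)
  refine le_trans ?_ (nsmul_eq_mul _ _).le
  refine Finset.sum_le_card_nsmul _ _ _ fun u _ => (measureReal_biUnion_finset_le _ _).trans ?_
  refine le_trans ?_ (nsmul_eq_mul _ _).le
  refine Finset.sum_le_card_nsmul _ _ _ fun v _ => ?_
  exact lower_tail_of_bounded hind hlaw (measurable_clipCrossSq T u v) (by positivity)
    (clipCrossSq_nonneg T · u v) (clipCrossSq_le hT · u v) hε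

/-- Failure probability of the good event, in terms of a net of the sphere. -/
theorem HasGaussianMoments.bad_sample_tail [IsProbabilityMeasure μ] [FiniteDimensional 𝕜 E]
    (hμ : HasGaussianMoments 𝕜 μ m) [IsProbabilityMeasure P] (hind : iIndepFun a P)
    (hlaw : ∀ i, HasLaw (a i) μ P) {δL δU T ε η K : ℝ} (hm : 0 < m)
    (hT : 0 < T) (hε : 0 < ε) (hε1 : ε ≤ 1) (hη : 0 < η) (hη2 : η ≤ 1 / 2) (hK : 1 ≤ K)
    (hU : (1 + m + ε) / (1 - η) ^ 2 ≤ 1 + m + δU)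
    (hL : 2 * (ε + 184 * T ^ 3 * η + 1536 / T ^ 2) / m ≤ δL)
    {N : Finset E} (hN1 : ∀ v ∈ N, ‖v‖ = 1) (hN : ∀ u : E, ‖u‖ = 1 → ∃ v ∈ N, ‖u - v‖ ≤ η)
    (xs : E) :
    P.real {ω | ¬ IsGoodSample 𝕜 (fun i => a i ω) xs m δL δU}
      ≤ n * (2 * Real.exp (-(K / 4))) + N.card * Real.exp (-(n * (ε ^ 2 / (400000 * K))))
        + N.card * Real.exp (-(n * (1 / 400000)))
        + N.card * (N.card * Real.exp (-(n * (2 * ε ^ 2 / (T ^ 4) ^ 2)))) := by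
  have hη1 : η < 1 := by linarith
  obtain ⟨e, he, hxe⟩ : ∃ e : E, (xs ≠ 0 → ‖e‖ = 1) ∧ xs = (‖xs‖ : 𝕜) • e := by
    rcases eq_or_ne xs 0 with h | h
    · exact ⟨0, fun h' => absurd h h', by simp [h]⟩
    · obtain ⟨e, he, hxe⟩ := exists_unit_smul (𝕜 := 𝕜) xs h
      exact ⟨e, fun _ => he, hxe⟩
  have hge := HasGaussianMoments.measurable_norm_inner (𝕜 := 𝕜) e
  -- B1: some projection on x_* exceeds the truncation level. B2: the truncated frame operator is
  -- too large. B3: the unweighted frame bound 36 = 9/(1 - 1/2)² fails. B4: a clipped energy is too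
  -- small on the net.
  set B1 : Set Ω := {ω | xs ≠ 0 ∧ ¬ ∀ i, ‖inner 𝕜 (a i ω) e‖ ^ 2 ≤ K}
  set B2 : Set Ω := {ω | xs ≠ 0 ∧ ¬ ∀ u : E, ∑ i, min (‖inner 𝕜 (a i ω) e‖ ^ 2) K *
    ‖inner 𝕜 (a i ω) u‖ ^ 2 ≤ n * (1 + m + ε) / (1 - η) ^ 2 * ‖u‖ ^ 2}
  set B3 : Set Ω := {ω | ¬ ∀ u : E, ∑ i, (1 : ℝ) *
    ‖inner 𝕜 (a i ω) u‖ ^ 2 ≤ n * (8 + 1) / (1 - η) ^ 2 * ‖u‖ ^ 2}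
  set B4 : Set Ω := {ω | ¬ ∀ u ∈ N, ∀ v ∈ N,
      ∑ i, (∫ y, clipCrossSq 𝕜 T y u v ∂μ - clipCrossSq 𝕜 T (a i ω) u v) ≤ n * ε}
  have h1 : P.real B1 ≤ n * (2 * Real.exp (-(K / 4))) := by
    by_cases h : xs = 0
    · have : B1 = ∅ := Set.eq_empty_of_forall_notMem fun ω hω => hω.1 h
      rw [this, measureReal_empty]; positivity
    · refine (measureReal_mono (fun ω hω => hω.2) (measure_ne_top _ _)).trans
        (hμ.max_tail hlaw (he h) K)
  have h2 : P.real B2 ≤ N.card * Real.exp (-(n * (ε ^ 2 / (400000 * K)))) := by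
    by_cases h : xs = 0
    · have : B2 = ∅ := Set.eq_empty_of_forall_notMem fun ω hω => hω.1 h
      rw [this, measureReal_empty]
      exact mul_nonneg (Nat.cast_nonneg _) (Real.exp_pos _).le
    · refine (measureReal_mono (fun ω hω => hω.2) (measure_ne_top _ _)).trans
        (hμ.weighted_sum_tail hind hlaw (w := fun x => min (‖inner 𝕜 x e‖ ^ 2) K) (by fun_prop)
          (fun x => le_min (sq_nonneg _) (by linarith)) hK (fun x => min_le_right _ _)
          (hμ.integral_truncated_sq_pow_le (he h) (by linarith)) hε hε1 (by linarith)
          (fun u hu => hμ.integral_truncated_mul_le hm.le (he h) hu (by linarith)) hη1 hN1 hN)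
  have h3 : P.real B3 ≤ N.card * Real.exp (-(n * (1 / 400000))) := by
    have := hμ.weighted_sum_tail hind hlaw (w := fun _ => 1) (by fun_prop) (K := 1) (b := 8)
      (ε := 1) (fun x => by norm_num) le_rfl (fun x => le_rfl) (by simp) one_pos le_rfl
      (by norm_num) (fun u hu => by simpa using hμ.integral_sq_le hu) hη1 hN1 hN
    simpa [B3] using this
  have h4 : P.real B4 ≤ N.card * (N.card * Real.exp (-(n * (2 * ε ^ 2 / (T ^ 4) ^ 2)))) :=
    clip_tail hind hlaw N hT hε.le
  have hsub : {ω | ¬ IsGoodSample 𝕜 (fun i => a i ω) xs m δL δU} ⊆ ((B1 ∪ B2) ∪ B3) ∪ B4 := by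
    intro ω hω
    by_contra hc
    simp only [Set.mem_union, not_or] at hc
    obtain ⟨⟨⟨g1, g2⟩, g3⟩, g4⟩ := hc
    simp only [B1, B2, B3, B4, Set.mem_ofPred_eq, not_and, not_not] at g1 g2 g3 g4
    refine hω ⟨fun u => ?_, fun x => ?_⟩
    · rcases eq_or_ne xs 0 with h | h
      · simp [h]
      have e1 : ∀ i, ‖inner 𝕜 (a i ω) xs‖ ^ 2
          = ‖xs‖ ^ 2 * min (‖inner 𝕜 (a i ω) e‖ ^ 2) K := fun i => by
        rw [min_eq_left (g1 h i)]
        conv_lhs => rw [hxe]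
        rw [norm_inner_real_smul_sq]
      simp only [e1, mul_assoc]
      rw [← Finset.mul_sum]
      calc _ ≤ ‖xs‖ ^ 2 * (n * (1 + m + ε) / (1 - η) ^ 2 * ‖u‖ ^ 2) := by gcongr; exact g2 h u
        _ = ‖xs‖ ^ 2 * (n * ((1 + m + ε) / (1 - η) ^ 2) * ‖u‖ ^ 2) := by ring
        _ ≤ ‖xs‖ ^ 2 * (n * (1 + m + δU) * ‖u‖ ^ 2) := by gcongr
        _ = _ := by ring
    · have hup : ∀ w : E, ∑ i, ‖inner 𝕜 (a i ω) w‖ ^ 2 ≤ n * 36 * ‖w‖ ^ 2 := fun w => by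
        have := g3 w
        simp only [one_mul] at this
        refine this.trans ?_
        gcongr
        rw [div_le_iff₀ (by nlinarith)]
        have h5 : 1 / 4 ≤ (1 - η) ^ 2 := by nlinarith
        have h6 : (0 : ℝ) ≤ n := Nat.cast_nonneg n
        nlinarith [mul_le_mul_of_nonneg_left h5 h6]
      have hlow := hμ.lower_isometry (fun i => a i ω) (ε := ε + 184 * T ^ 3 * η + 1536 / T ^ 2) hm
        (by positivity) (cross_sum_lower_of_unit _ fun u v hu hv =>
          hμ.cross_sum_lower_of_net (fun i => a i ω) hT hη hN hup g4 hu hv) x xs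
      refine le_trans ?_ hlow
      -- The bracket is an expected square; its sign is needed to weaken the relative error to δL.
      have hQ : 0 ≤ m * ((‖x‖ ^ 2) ^ 2 + (‖xs‖ ^ 2) ^ 2 - 2 * ‖inner 𝕜 x xs‖ ^ 2)
          + (‖x‖ ^ 2 - ‖xs‖ ^ 2) ^ 2 := by
        rw [← hμ.integral_sub_sq]
        exact integral_nonneg fun _ => sq_nonneg _
      gcongr
  calc _ ≤ P.real (((B1 ∪ B2) ∪ B3) ∪ B4) := measureReal_mono hsub (measure_ne_top _ _)
    _ ≤ P.real B1 + P.real B2 + P.real B3 + P.real B4 := by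
      have i1 := measureReal_union_le (μ := P) ((B1 ∪ B2) ∪ B3) B4
      have i2 := measureReal_union_le (μ := P) (B1 ∪ B2) B3
      have i3 := measureReal_union_le (μ := P) B1 B2
      linarith
    _ ≤ _ := by linarith

end Tails

/-- The lower error is split into three equal parts s = mδL/6. T is fixed first, because the bound
on η depends on it. For the upper bound, half of δU goes to ε and the rest to the net factor (1 -
η)⁻². -/
theorem exists_net_parameters {m δL δU : ℝ} (hm : 0 < m) (hL : 0 < δL) (hU : 0 < δU) :
    ∃ T ε η : ℝ, 0 < T ∧ 0 < ε ∧ ε ≤ 1 ∧ 0 < η ∧ η ≤ 1 / 2 ∧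
      (1 + m + ε) / (1 - η) ^ 2 ≤ 1 + m + δU ∧
      2 * (ε + 184 * T ^ 3 * η + 1536 / T ^ 2) / m ≤ δL := by
  set s := m * δL / 6 with hs
  have hs0 : 0 < s := by positivity
  set T := √(1536 / s) with hT
  have hT0 : 0 < T := Real.sqrt_pos.2 (by positivity)
  have hT2 : 1536 / T ^ 2 = s := by
    rw [hT, Real.sq_sqrt (by positivity)]; field_simp
  set ε := min (min 1 s) (δU / 2) with hε
  have hε0 : 0 < ε := by positivity
  set q := 1 + m + δU with hq
  set η := min (min (1 / 2) (s / (184 * T ^ 3))) (δU / (4 * q)) with hη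
  have hη0 : 0 < η := by positivity
  have hη1 : η ≤ 1 / 2 := (min_le_left _ _).trans (min_le_left _ _)
  have hη2 : η ≤ s / (184 * T ^ 3) := (min_le_left _ _).trans (min_le_right _ _)
  have hη3 : η ≤ δU / (4 * q) := min_le_right _ _
  have hε1 : ε ≤ 1 := (min_le_left _ _).trans (min_le_left _ _)
  have hε2 : ε ≤ s := (min_le_left _ _).trans (min_le_right _ _)
  have hε3 : ε ≤ δU / 2 := min_le_right _ _
  refine ⟨T, ε, η, hT0, hε0, hε1, hη0, hη1, ?_, ?_⟩
  · have h1 : 0 < (1 - η) ^ 2 := by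
      have : 0 < 1 - η := by linarith
      positivity
    rw [div_le_iff₀ h1]
    rw [le_div_iff₀ (by positivity)] at hη3
    have h2 : 1 - 2 * η ≤ (1 - η) ^ 2 := by nlinarith [sq_nonneg η]
    have h3 := mul_le_mul_of_nonneg_left h2 (by positivity : 0 ≤ q)
    linarith
  · rw [hT2, div_le_iff₀ hm]
    rw [le_div_iff₀ (by positivity)] at hη2
    have : 184 * T ^ 3 * η ≤ s := by linarith
    have h6 : 6 * s = δL * m := by rw [hs]; ring
    linarith

theorem exists_good_sample_probability (𝕜 : Type*) [RCLike 𝕜] [MeasurableSpace 𝕜] [BorelSpace 𝕜]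
    {m δL δU : ℝ} (hm : 0 < m) (hL : 0 < δL) (hU : 0 < δU) :
    ∃ c₁ c₂ : ℝ, 0 < c₁ ∧ 0 < c₂ ∧ ∀ d n : ℕ, 1 ≤ n → c₁ * d * Real.log d ≤ n →
      ∀ (μ : Measure (EuclideanSpace 𝕜 (Fin d))) [IsProbabilityMeasure μ],
        HasGaussianMoments 𝕜 μ m →
      ∀ (xs : EuclideanSpace 𝕜 (Fin d)) (Ω : Type*) [MeasurableSpace Ω] (P : Measure Ω)
        [IsProbabilityMeasure P] (a : Fin n → Ω → EuclideanSpace 𝕜 (Fin d)),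
        iIndepFun a P → (∀ i, HasLaw (a i) μ P) →
        1 - c₂ * ((n : ℝ) ^ 2)⁻¹ ≤ P.real {ω | IsGoodSample 𝕜 (fun i => a i ω) xs m δL δU} := by
  obtain ⟨T, ε, η, hT, hε, hε1, hη, hη2, hpU, hpL⟩ := exists_net_parameters hm hL hU
  -- The real dimension is at most 2d over either field, so exp(κd/2) bounds the net and exp(κd)
  -- bounds its pairs.
  set κ := 4 * Real.log (2 / η + 1) with hκ
  have hbase : 1 < 2 / η + 1 := by
    have : 0 < 2 / η := by positivity
    linarith
  have hκ0 : 0 < κ := mul_pos (by norm_num) (Real.log_pos hbase)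
  set c := min (ε ^ 2 / 400000) (2 * ε ^ 2 / (T ^ 4) ^ 2) with hc
  have hc0 : 0 < c := by positivity
  have hc1 : c ≤ ε ^ 2 / 400000 := min_le_left _ _
  have hc2 : c ≤ 2 * ε ^ 2 / (T ^ 4) ^ 2 := min_le_right _ _
  have hc3 : c ≤ 1 / 400000 := hc1.trans (by gcongr; nlinarith)
  obtain ⟨c₁, n₀, hc₁, hsize⟩ := exists_sample_size hκ0 hc0
  -- The four failure terms contribute 2 + 1 + 1 + 1; the summand n₀² makes the claim vacuous for n
  -- < n₀.
  refine ⟨c₁, 5 + (n₀ : ℝ) ^ 2, hc₁, by positivity, ?_⟩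
  intro d n hn hdn μ _ hμ xs Ω _ P _ a hind hlaw
  have hn0 : (0 : ℝ) < n := by exact_mod_cast hn
  rcases lt_or_ge n n₀ with hlt | hge
  · refine le_trans ?_ measureReal_nonneg
    rw [sub_nonpos, ← div_eq_mul_inv, le_div_iff₀ (by positivity), one_mul]
    have : (n : ℝ) ≤ n₀ := by exact_mod_cast hlt.le
    nlinarith
  have hexp := hsize d n hge hdn
  obtain ⟨N, hN1, hN, hcard⟩ := exists_sphere_net (EuclideanSpace 𝕜 (Fin d)) hη
  have hlog : 0 ≤ Real.log n := Real.log_natCast_nonneg n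
  -- Then exp(-K/4) ≤ n⁻³, enough for a union over n samples.
  set K := 1 + 12 * Real.log n with hK
  have hK1 : 1 ≤ K := by linarith
  have htail := hμ.bad_sample_tail hind hlaw hm hT hε hε1 hη hη2 hK1 hpU hpL hN1 hN xs
  have hcard1 : (N.card : ℝ) ≤ Real.exp (κ * d / 2) := by
    refine hcard.trans ((pow_le_pow_right₀ hbase.le (finrank_euclideanSpace_le 𝕜 d)).trans ?_)
    rw [← Real.exp_log (by positivity : 0 < (2 / η + 1) ^ (2 * d)), Real.log_pow, hκ]
    apply le_of_eq
    congr 1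
    push_cast
    ring
  have hκd : 0 ≤ κ * d := by positivity
  have hcard2 : (N.card : ℝ) ≤ Real.exp (κ * d) :=
    hcard1.trans (Real.exp_le_exp.2 (by linarith))
  have hcard3 : (N.card : ℝ) * N.card ≤ Real.exp (κ * d) := by
    calc (N.card : ℝ) * N.card ≤ Real.exp (κ * d / 2) * Real.exp (κ * d / 2) := by gcongr
      _ = Real.exp (κ * d) := by rw [← Real.exp_add]; congr 1; ring
  have hsq : Real.exp (-2 * Real.log n) = ((n : ℝ) ^ 2)⁻¹ := by
    rw [show -2 * Real.log n = -(((2 : ℕ) : ℝ) * Real.log n) by push_cast; ring, Real.exp_neg,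
      Real.exp_nat_mul, Real.exp_log hn0]
  have hdecay : ∀ r : ℝ, c / K ≤ r → Real.exp (κ * d) * Real.exp (-(n * r)) ≤ ((n : ℝ) ^ 2)⁻¹ := by
    intro r hr
    rw [← Real.exp_add, ← hsq, Real.exp_le_exp]
    have : n * (c / K) ≤ n * r := by gcongr
    have e : c * n / K = n * (c / K) := by ring
    linarith
  have hcK : c / K ≤ c := div_le_self hc0.le hK1
  have t1 : (n : ℝ) * (2 * Real.exp (-(K / 4))) ≤ 2 * ((n : ℝ) ^ 2)⁻¹ := by
    have e1 : Real.exp (-(K / 4)) ≤ Real.exp (-2 * Real.log n) * Real.exp (-Real.log n) := by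
      rw [← Real.exp_add, Real.exp_le_exp]; linarith
    rw [hsq, Real.exp_neg (Real.log n), Real.exp_log hn0] at e1
    calc (n : ℝ) * (2 * Real.exp (-(K / 4))) ≤ n * (2 * (((n : ℝ) ^ 2)⁻¹ * (n : ℝ)⁻¹)) := by gcongr
      _ = _ := by field_simp
  have t2 : N.card * Real.exp (-(n * (ε ^ 2 / (400000 * K)))) ≤ ((n : ℝ) ^ 2)⁻¹ := by
    refine le_trans ?_ (hdecay (ε ^ 2 / (400000 * K)) ?_)
    · gcongr
    · rw [← div_div]; gcongr
  have t3 : N.card * Real.exp (-(n * (1 / 400000 : ℝ))) ≤ ((n : ℝ) ^ 2)⁻¹ := by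
    refine le_trans ?_ (hdecay (1 / 400000) (hcK.trans hc3))
    gcongr
  have t4 : N.card * (N.card * Real.exp (-(n * (2 * ε ^ 2 / (T ^ 4) ^ 2)))) ≤ ((n : ℝ) ^ 2)⁻¹ := by
    refine le_trans ?_ (hdecay (2 * ε ^ 2 / (T ^ 4) ^ 2) (hcK.trans hc2))
    rw [← mul_assoc]
    gcongr
  have hbad : P.real {ω | ¬ IsGoodSample 𝕜 (fun i => a i ω) xs m δL δU}
      ≤ 5 * ((n : ℝ) ^ 2)⁻¹ := by linarith
  -- Subadditivity gives the complement bound without measurability of the good event.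
  have hun := measureReal_union_le (μ := P) {ω | IsGoodSample 𝕜 (fun i => a i ω) xs m δL δU}
    {ω | ¬ IsGoodSample 𝕜 (fun i => a i ω) xs m δL δU}
  have huniv : {ω | IsGoodSample 𝕜 (fun i => a i ω) xs m δL δU}
    ∪ {ω | ¬ IsGoodSample 𝕜 (fun i => a i ω) xs m δL δU} = Set.univ := by
    ext ω
    simp [em]
  rw [huniv, probReal_univ] at hun
  have h0 : 0 ≤ (n₀ : ℝ) ^ 2 * ((n : ℝ) ^ 2)⁻¹ := by positivity
  linarith

end GoodSample

/-! ### From good samples to the measurement conditions. -/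

section Measurements

open RCLike

variable {𝕜 : Type*} [RCLike 𝕜]

theorem isHermitian_outer {d : ℕ} (x : Fin d → 𝕜) : (outer x).IsHermitian := by
  ext i j
  simp [outer, Matrix.vecMulVec_apply, mul_comm]

theorem inner_toEuclideanCLM_outer {d : ℕ} (b : Fin d → 𝕜) (u v : EuclideanSpace 𝕜 (Fin d)) :
    inner 𝕜 u (Matrix.toEuclideanCLM (n := Fin d) (𝕜 := 𝕜) (outer b) v)
      = star (inner 𝕜 (WithLp.toLp 2 b) u) * inner 𝕜 (WithLp.toLp 2 b) v := by
  rw [inner_toEuclideanCLM]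
  simp only [PiLp.inner_apply, RCLike.inner_apply, RCLike.star_def, map_sum, map_mul,
    RCLike.conj_conj, outer, Matrix.vecMulVec_apply, Pi.star_apply, Finset.sum_mul_sum]
  refine Finset.sum_congr rfl fun i _ => Finset.sum_congr rfl fun j _ => by ring

theorem quadForm_outer {d : ℕ} (b : Fin d → 𝕜) (u : EuclideanSpace 𝕜 (Fin d)) :
    quadForm (outer b) u u = ‖inner 𝕜 (WithLp.toLp 2 b) u‖ ^ 2 := by
  rw [quadForm, inner_toEuclideanCLM_outer, RCLike.star_def, RCLike.conj_mul, ← RCLike.ofReal_pow,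
    RCLike.ofReal_re]

theorem opNorm_le_of_bilin {d : ℕ} {M : Matrix (Fin d) (Fin d) 𝕜} {B : ℝ} (hB : 0 ≤ B)
    (h : ∀ u v : EuclideanSpace 𝕜 (Fin d),
      ‖inner 𝕜 u (Matrix.toEuclideanCLM (n := Fin d) (𝕜 := 𝕜) M v)‖ ≤ B * ‖u‖ * ‖v‖) :
    opNorm M ≤ B := by
  refine ContinuousLinearMap.opNorm_le_bound _ hB fun v => ?_
  set w := Matrix.toEuclideanCLM (n := Fin d) (𝕜 := 𝕜) M v
  have h1 : ‖inner 𝕜 w w‖ ≤ B * ‖w‖ * ‖v‖ := h w v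
  rw [inner_self_eq_norm_sq_to_K, norm_pow, RCLike.norm_ofReal, abs_of_nonneg (norm_nonneg _)] at h1
  rcases (norm_nonneg w).eq_or_lt with h0 | h0
  · rw [← h0]; positivity
  · have : ‖w‖ * ‖w‖ ≤ ‖w‖ * (B * ‖v‖) := by nlinarith
    exact le_of_mul_le_mul_left this h0

/-- Cauchy–Schwarz passes from the quadratic form to the bilinear form, as the operator norm
requires. -/
theorem norm_weighted_sum_le {E : Type*} [NormedAddCommGroup E] [InnerProductSpace 𝕜 E] {n : ℕ}
    (w : Fin n → ℝ) (hw : ∀ i, 0 ≤ w i) (b : Fin n → E) {B : ℝ} (hB : 0 ≤ B)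
    (h : ∀ u : E, ∑ i, w i * ‖inner 𝕜 (b i) u‖ ^ 2 ≤ B * ‖u‖ ^ 2) (u v : E) :
    ∑ i, w i * (‖inner 𝕜 (b i) u‖ * ‖inner 𝕜 (b i) v‖) ≤ B * ‖u‖ * ‖v‖ := by
  have hcs := Finset.sum_mul_sq_le_sq_mul_sq Finset.univ (fun i => √(w i) * ‖inner 𝕜 (b i) u‖)
    (fun i => √(w i) * ‖inner 𝕜 (b i) v‖)
  have e1 : ∀ i, √(w i) * ‖inner 𝕜 (b i) u‖ * (√(w i) * ‖inner 𝕜 (b i) v‖)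
      = w i * (‖inner 𝕜 (b i) u‖ * ‖inner 𝕜 (b i) v‖) := fun i => by
    calc _ = (√(w i) * √(w i)) * (‖inner 𝕜 (b i) u‖ * ‖inner 𝕜 (b i) v‖) := by ring
      _ = _ := by rw [Real.mul_self_sqrt (hw i)]
  have e2 : ∀ i x, (√(w i) * ‖inner 𝕜 (b i) x‖) ^ 2 = w i * ‖inner 𝕜 (b i) x‖ ^ 2 := fun i x => by
    rw [mul_pow, Real.sq_sqrt (hw i)]
  simp only [e1, e2] at hcs
  refine abs_le_of_sq_le_sq' ?_ (by positivity) |>.2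
  calc _ ≤ _ := hcs
    _ ≤ (B * ‖u‖ ^ 2) * (B * ‖v‖ ^ 2) := by
      gcongr
      · exact Finset.sum_nonneg fun i _ => mul_nonneg (hw i) (sq_nonneg _)
      · exact h u
      · exact h v
    _ = _ := by ring

theorem one_div_natCast_mul_le {n : ℕ} {s t : ℝ} (ht : 0 ≤ t) (h : s ≤ n * t) :
    1 / (n : ℝ) * s ≤ t := by
  rcases Nat.eq_zero_or_pos n with rfl | hn
  · simpa using ht
  · have : (0 : ℝ) < n := by exact_mod_cast hn
    rw [one_div, inv_mul_le_iff₀ this]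
    exact h

theorem le_one_div_natCast_mul {n : ℕ} (hn : 1 ≤ n) {s t : ℝ} (h : n * t ≤ s) :
    t ≤ 1 / (n : ℝ) * s := by
  have : (0 : ℝ) < n := by exact_mod_cast hn
  rw [one_div, le_inv_mul_iff₀ this]
  exact h

theorem inner_measAdj {d n : ℕ} {A : Fin n → Matrix (Fin d) (Fin d) 𝕜}
    (hA : ∀ i, (A i).IsHermitian) (xs u v : EuclideanSpace 𝕜 (Fin d)) :
    inner 𝕜 u (Matrix.toEuclideanCLM (n := Fin d) (𝕜 := 𝕜)
      (measAdj A (measOp A (outer xs.ofLp))) v)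
      = ∑ i, (quadForm (A i) xs xs : 𝕜)
        * inner 𝕜 u (Matrix.toEuclideanCLM (n := Fin d) (𝕜 := 𝕜) (A i) v) := by
  simp only [measAdj, measOp, trace_conjTranspose_mul_outer (hA _), map_sum,
    sum_apply, inner_sum]
  refine Finset.sum_congr rfl fun i _ => ?_
  simp only [inner_toEuclideanCLM, Matrix.smul_apply, RCLike.real_smul_eq_coe_mul, Finset.mul_sum]
  refine Finset.sum_congr rfl fun i _ => Finset.sum_congr rfl fun j _ => by ring

/-- The measurement conditions from a good sample, whenever the measurement matrices act as the
rank one forms of vectors in a possibly larger space. -/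
theorem IsGoodSample.measurementCondition {𝕂 : Type*} [RCLike 𝕂] {E : Type*}
    [NormedAddCommGroup E] [InnerProductSpace 𝕂 E] {d n : ℕ} (hn : 1 ≤ n)
    {A : Fin n → Matrix (Fin d) (Fin d) 𝕜} (hA : ∀ i, (A i).IsHermitian) {b : Fin n → E}
    (J : EuclideanSpace 𝕜 (Fin d) → E) (hJ : ∀ u, ‖J u‖ = ‖u‖)
    (hJi : ∀ u v, ‖inner 𝕂 (J u) (J v)‖ = ‖inner 𝕜 u v‖)
    (hq : ∀ i u, quadForm (A i) u u = ‖inner 𝕂 (b i) (J u)‖ ^ 2)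
    (hb : ∀ i u v, ‖inner 𝕜 u (Matrix.toEuclideanCLM (n := Fin d) (𝕜 := 𝕜) (A i) v)‖
      ≤ ‖inner 𝕂 (b i) (J u)‖ * ‖inner 𝕂 (b i) (J v)‖)
    {xs : EuclideanSpace 𝕜 (Fin d)} {m δL δU : ℝ} (hm : 0 ≤ 1 + m + δU)
    (h : IsGoodSample 𝕂 b (J xs) m δL δU) : MeasurementCondition A xs m δL δU := by
  constructor
  · refine one_div_natCast_mul_le (by positivity) (opNorm_le_of_bilin (by positivity) ?_)
    intro u v
    rw [inner_measAdj hA]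
    refine (norm_sum_le _ _).trans ?_
    have hsum : ∑ i, ‖inner 𝕂 (b i) (J xs)‖ ^ 2
        * (‖inner 𝕂 (b i) (J u)‖ * ‖inner 𝕂 (b i) (J v)‖)
        ≤ n * ((1 + m + δU) * ‖J xs‖ ^ 2) * ‖J u‖ * ‖J v‖ :=
      norm_weighted_sum_le _ (fun i => sq_nonneg _) b (by positivity) h.1 (J u) (J v)
    rw [hJ, hJ, hJ] at hsum
    refine le_trans (Finset.sum_le_sum fun i _ => ?_) hsum
    rw [norm_mul, RCLike.norm_ofReal, hq, abs_of_nonneg (sq_nonneg _)]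
    gcongr
    exact hb i u v
  · intro x
    refine le_one_div_natCast_mul hn ?_
    rw [norm_sq_measOp_sub hA, frobNorm_sq_outer_sub]
    have := h.2 (J x)
    rw [hJ, hJ, hJi] at this
    simpa only [hq] using this

theorem IsGoodSample.measurementCondition_outer {d n : ℕ} (hn : 1 ≤ n) {a : Fin n → Fin d → 𝕜}
    {xs : EuclideanSpace 𝕜 (Fin d)} {m δL δU : ℝ} (hm : 0 ≤ 1 + m + δU)
    (h : IsGoodSample 𝕜 (fun i => WithLp.toLp 2 (a i)) xs m δL δU) :
    MeasurementCondition (fun i => outer (a i)) xs m δL δU :=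
  IsGoodSample.measurementCondition (b := fun i => WithLp.toLp 2 (a i)) hn
    (fun i => isHermitian_outer _) id (fun _ => rfl)
    (fun _ _ => rfl) (fun i u => quadForm_outer _ _)
    (fun i u v => by
      rw [inner_toEuclideanCLM_outer, norm_mul, norm_star]; rfl) hm h

/-- The inclusion of real vectors into complex vectors. -/
noncomputable def complexify {d : ℕ} (u : EuclideanSpace ℝ (Fin d)) : EuclideanSpace ℂ (Fin d) :=
  WithLp.toLp 2 fun j => (u j : ℂ)

theorem norm_complexify {d : ℕ} (u : EuclideanSpace ℝ (Fin d)) : ‖complexify u‖ = ‖u‖ := by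
  rw [EuclideanSpace.norm_eq, EuclideanSpace.norm_eq]
  simp [complexify]

theorem inner_complexify {d : ℕ} (u v : EuclideanSpace ℝ (Fin d)) :
    inner ℂ (complexify u) (complexify v) = ((inner ℝ u v : ℝ) : ℂ) := by
  simp [PiLp.inner_apply, complexify]

/-- On real vectors Re(bb^*) acts as the real part of the complex rank-one form, so the third model
inherits the complex estimates. -/
theorem inner_re_outer {d : ℕ} (b : Fin d → ℂ) (u v : EuclideanSpace ℝ (Fin d)) :
    inner ℝ u (Matrix.toEuclideanCLM (n := Fin d) (𝕜 := ℝ) ((outer b).map Complex.re) v)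
      = re (star (inner ℂ (WithLp.toLp 2 b) (complexify u))
        * inner ℂ (WithLp.toLp 2 b) (complexify v)) := by
  rw [← inner_toEuclideanCLM_outer, inner_toEuclideanCLM, inner_toEuclideanCLM]
  simp only [map_sum, complexify, Matrix.map_apply]
  refine Finset.sum_congr rfl fun i _ => Finset.sum_congr rfl fun j _ => ?_
  simp

theorem isHermitian_re_outer {d : ℕ} (b : Fin d → ℂ) :
    ((outer b).map Complex.re).IsHermitian := by
  ext i j
  have := (isHermitian_outer b).apply i j
  rw [Matrix.conjTranspose_apply, Matrix.map_apply, Matrix.map_apply, ← this]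
  simp

theorem IsGoodSample.measurementCondition_re_outer {d n : ℕ} (hn : 1 ≤ n) {a : Fin n → Fin d → ℂ}
    {xs : EuclideanSpace ℝ (Fin d)} {m δL δU : ℝ} (hm : 0 ≤ 1 + m + δU)
    (h : IsGoodSample ℂ (fun i => WithLp.toLp 2 (a i)) (complexify xs) m δL δU) :
    MeasurementCondition (fun i => (outer (a i)).map Complex.re) xs m δL δU :=
  IsGoodSample.measurementCondition (b := fun i => WithLp.toLp 2 (a i)) hn
    (fun i => isHermitian_re_outer _) complexify norm_complexify
    (fun u v => by rw [inner_complexify, Complex.norm_real])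
    (fun i u => by
      rw [quadForm, inner_re_outer, RCLike.star_def, RCLike.conj_mul, ← RCLike.ofReal_pow]
      exact RCLike.ofReal_re (K := ℂ) _)
    (fun i u v => by
      rw [inner_re_outer, Real.norm_eq_abs]
      refine (RCLike.abs_re_le_norm _).trans ?_
      rw [norm_mul, norm_star]) hm h

end Measurements

/-! ### Random vectors in Euclidean space and the numerical constants. -/

section Sampling

variable {𝕜 : Type*} [MeasurableSpace 𝕜] {Ω : Type*} [MeasurableSpace Ω]
  {d n : ℕ} {γ : Measure 𝕜} {P : Measure Ω} {a : Fin n → Ω → Fin d → 𝕜}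

theorem IsIIDVectors.iIndepFun_toLp (h : IsIIDVectors γ P a) :
    iIndepFun (fun i ω => (WithLp.toLp 2 (a i ω) : EuclideanSpace 𝕜 (Fin d))) P :=
  h.1.comp (fun _ => WithLp.toLp 2) fun _ => by fun_prop

theorem IsIIDVectors.hasLaw_toLp (h : IsIIDVectors γ P a) (i : Fin n) :
    HasLaw (fun ω => (WithLp.toLp 2 (a i ω) : EuclideanSpace 𝕜 (Fin d)))
      ((Measure.pi fun _ : Fin d => γ).map (WithLp.toLp 2)) P :=
  HasLaw.fun_comp ⟨by fun_prop, rfl⟩ (h.2 i)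

theorem isProbabilityMeasure_map_toLp [IsProbabilityMeasure γ] (d : ℕ) :
    IsProbabilityMeasure ((Measure.pi fun _ : Fin d => γ).map
      (WithLp.toLp 2 : (Fin d → 𝕜) → EuclideanSpace 𝕜 (Fin d))) :=
  Measure.isProbabilityMeasure_map (by fun_prop)

end Sampling

/-- The margin m² + 2m - 2 is 6 for m = 2 but only 1 for m = 1, hence the smaller tolerances in the
complex case. -/
theorem admissible_real : AdmissibleConstants 2 (1 / 8) (1 / 8) := by
  norm_num [AdmissibleConstants]

theorem admissible_complex : AdmissibleConstants 1 (1 / 18) (1 / 18) := by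
  norm_num [AdmissibleConstants]

end PhaseRetrieval

open PhaseRetrieval in
open scoped ComplexOrder in
theorem theorem1 :
    -- Part 1: the deterministic landscape result, over the reals or the complex numbers
    (∀ (𝕜 : Type*) [RCLike 𝕜] (d n : ℕ) (A : Fin n → Matrix (Fin d) (Fin d) 𝕜)
        (xs : EuclideanSpace 𝕜 (Fin d)) (m δL δU : ℝ),
      (∀ i, (A i).PosSemidef) →
      AdmissibleConstants m δL δU →
      MeasurementCondition A xs m δL δU →
      ∀ x : EuclideanSpace 𝕜 (Fin d),
        IsSecondOrderCritical (objective A (measOp A (outer xs.ofLp))) x →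
          outer x.ofLp = outer xs.ofLp ∧ ∃ s : 𝕜, ‖s‖ = 1 ∧ x = s • xs) ∧
    -- Part 2: Gaussian measurements
    (∃ c₁ c₂ : ℝ, 0 < c₁ ∧ 0 < c₂ ∧
      -- real signal, real measurement vectors
      (∃ δL δU : ℝ, AdmissibleConstants (moment4 stdReal) δL δU ∧
        ∀ (d n : ℕ), 1 ≤ n → c₁ * d * Real.log d ≤ n →
        ∀ (xs : EuclideanSpace ℝ (Fin d))
          (Ω : Type*) [MeasurableSpace Ω] (P : Measure Ω) [IsProbabilityMeasure P]
          (a : Fin n → Ω → Fin d → ℝ), IsIIDVectors stdReal P a →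
          1 - c₂ * ((n : ℝ) ^ 2)⁻¹ ≤
            P.real {ω | MeasurementCondition (fun i => outer (a i ω)) xs
              (moment4 stdReal) δL δU}) ∧
      -- complex signal, complex measurement vectors
      (∃ δL δU : ℝ, AdmissibleConstants (moment4 stdComplex) δL δU ∧
        ∀ (d n : ℕ), 1 ≤ n → c₁ * d * Real.log d ≤ n →
        ∀ (xs : EuclideanSpace ℂ (Fin d))
          (Ω : Type*) [MeasurableSpace Ω] (P : Measure Ω) [IsProbabilityMeasure P]
          (a : Fin n → Ω → Fin d → ℂ), IsIIDVectors stdComplex P a →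
          1 - c₂ * ((n : ℝ) ^ 2)⁻¹ ≤
            P.real {ω | MeasurementCondition (fun i => outer (a i ω)) xs
              (moment4 stdComplex) δL δU}) ∧
      -- real signal, real parts of complex rank-one measurement matrices
      (∃ δL δU : ℝ, AdmissibleConstants (moment4 stdComplex) δL δU ∧
        ∀ (d n : ℕ), 1 ≤ n → c₁ * d * Real.log d ≤ n →
        ∀ (xs : EuclideanSpace ℝ (Fin d))
          (Ω : Type*) [MeasurableSpace Ω] (P : Measure Ω) [IsProbabilityMeasure P]
          (a : Fin n → Ω → Fin d → ℂ), IsIIDVectors stdComplex P a →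
          1 - c₂ * ((n : ℝ) ^ 2)⁻¹ ≤
            P.real {ω | MeasurementCondition (fun i => (outer (a i ω)).map Complex.re) xs
              (moment4 stdComplex) δL δU})) := by
  refine ⟨?_, ?_⟩
  · intro 𝕜 _ d n A xs m δL δU hA hc hM x hx
    have h := landscape (fun i => (hA i).isHermitian) (fun i => quadForm_self_nonneg (hA i)) hc hM hx
    exact ⟨h, exists_phase_of_outer_eq h⟩
  · obtain ⟨r₁, r₂, hr₁, hr₂, hR⟩ := exists_good_sample_probability ℝ (m := 2) (δL := 1 / 8)
      (δU := 1 / 8) (by norm_num) (by norm_num) (by norm_num)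
    obtain ⟨s₁, s₂, hs₁, hs₂, hC⟩ := exists_good_sample_probability ℂ (m := 1) (δL := 1 / 18)
      (δU := 1 / 18) (by norm_num) (by norm_num) (by norm_num)
    -- A second copy of the complex statement: the sample spaces of the two complex cases range over
    -- independent universes.
    obtain ⟨t₁, t₂, ht₁, ht₂, hC'⟩ := exists_good_sample_probability ℂ (m := 1) (δL := 1 / 18)
      (δU := 1 / 18) (by norm_num) (by norm_num) (by norm_num)
    have hmono : ∀ (c c' : ℝ) (d n : ℕ), c ≤ c' → c' * d * Real.log d ≤ n →
        c * d * Real.log d ≤ n := fun c c' d n hcc h => by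
      refine le_trans ?_ h
      have : 0 ≤ Real.log d := Real.log_natCast_nonneg d
      gcongr
    have hmono' : ∀ (c c' : ℝ) (n : ℕ), c ≤ c' →
        1 - c' * ((n : ℝ) ^ 2)⁻¹ ≤ 1 - c * ((n : ℝ) ^ 2)⁻¹ := fun c c' n hcc => by gcongr
    rw [moment4_stdReal, moment4_stdComplex]
    refine ⟨max r₁ (max s₁ t₁), max r₂ (max s₂ t₂), lt_max_of_lt_left hr₁, lt_max_of_lt_left hr₂,
      ⟨1 / 8, 1 / 8, admissible_real, ?_⟩, ⟨1 / 18, 1 / 18, admissible_complex, ?_⟩,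
      ⟨1 / 18, 1 / 18, admissible_complex, ?_⟩⟩
    · intro d n hn hdn xs Ω _ P _ a ha
      have := isProbabilityMeasure_map_toLp (γ := stdReal) d
      refine (hmono' _ _ n (le_max_left _ _)).trans ((hR d n hn
        (hmono _ _ d n (le_max_left _ _) hdn) _
        (hasGaussianMoments_real (isIsotropicGaussian_stdReal.pi d)) xs Ω P _ ha.iIndepFun_toLp
        ha.hasLaw_toLp).trans (measureReal_mono fun ω hω => ?_))
      exact hω.measurementCondition_outer hn (by norm_num)
    · intro d n hn hdn xs Ω _ P _ a ha
      have := isProbabilityMeasure_map_toLp (γ := stdComplex) d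
      refine (hmono' _ _ n ((le_max_left _ _).trans (le_max_right _ _))).trans ((hC d n hn
        (hmono _ _ d n ((le_max_left _ _).trans (le_max_right _ _)) hdn) _
        (hasGaussianMoments_complex (isIsotropicGaussian_stdComplex.pi d)) xs Ω P _
        ha.iIndepFun_toLp ha.hasLaw_toLp).trans (measureReal_mono fun ω hω => ?_))
      exact hω.measurementCondition_outer hn (by norm_num)
    · intro d n hn hdn xs Ω _ P _ a ha
      have := isProbabilityMeasure_map_toLp (γ := stdComplex) d
      refine (hmono' _ _ n ((le_max_right _ _).trans (le_max_right _ _))).trans ((hC' d n hn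
        (hmono _ _ d n ((le_max_right _ _).trans (le_max_right _ _)) hdn) _
        (hasGaussianMoments_complex (isIsotropicGaussian_stdComplex.pi d)) (complexify xs) Ω P _
        ha.iIndepFun_toLp ha.hasLaw_toLp).trans (measureReal_mono fun ω hω => ?_))
      exact hω.measurementCondition_re_outer hn (by norm_num)
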